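/- Let $K\subset\mathbb R^2$ be a closed, bounded, strictly convex domain whose boundary $\gamma$ is a smooth regular simple closed curve with positive curvature. Write $\theta$ for the angle between the $x$-axis and the outward normal of $\gamma$, $p_K(\theta)=\max_{x\in K}\langle x,(\cos\theta,\sin\theta)\rangle$ for the support function, and $\gamma(\theta)=(p_K\cos\theta-p_K'\sin\theta,\;p_K\sin\theta+p_K'\cos\theta)$ for the parametrization of $\gamma$ by $\theta$. Let $\kappa$ be the curvature of $\gamma$, $\rho=1/\kappa$ its curvature radius, $\rho_M$ and $\rho_m$ the maximum and minimum of $\rho$, $L$ the length of $\gamma$, $A$ the area of $K$, and $\rho_e$, $\rho_i$ the circumradius and inradius of $K$. Let $\beta(\theta)=\gamma(\theta)-\rho(\theta)(\cos\theta,\sin\theta)$ be the locus of curvature centers, $\tilde A=\frac12\oint_\beta \beta_1\,\mathrm d\beta_2-\beta_2\,\mathrm d\beta_1$ its oriented area, and $\rho_\beta=|p_K'+p_K'''|$ its curvature radius (equal to $0$ where $\beta'=0$). For real parameters $(\alpha,\delta,\mu,\sigma,\eta,\lambda,\xi,\zeta)$ put $$W=\alpha\int_0^{2\pi}\rho^2\,\mathrm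 d\theta+\delta L^2+\mu A+\sigma|\tilde A|+\eta\int_0^{2\pi}\rho_\beta^2\,\mathrm d\theta+\lambda(\rho_e-\rho_i)^2+\xi(\rho_M-\rho_m)^2+\zeta\oint_\gamma\kappa^2\,\mathrm ds .$$ The Steiner disk $S(K)$ is the disk with center $\frac1\pi\int_0^{2\pi}p_K(\theta)(\cos\theta,\sin\theta)\,\mathrm d\theta$ and radius $\frac{L}{2\pi}$. For convex domains $K,K'$ let $$h_1(K,K')=\max_{\theta\in[0,2\pi]}|p_K(\theta)-p_{K'}(\theta)|,\qquad h_2(K,K')=\Big(\int_0^{2\pi}|p_K(\theta)-p_{K'}(\theta)|^2\,\mathrm d\theta\Big)^{1/2}.$$ Suppose that the parameters satisfy $\eta,\xi,\zeta\ge 0$, $\lambda\le 0$, $2\alpha+4\pi\delta+\mu-4\zeta\ge 0$, $2\alpha+\sigma-2\eta-4\zeta\ge 0$ and $$6\pi\alpha-\pi\mu+4\pi\sigma+24\pi\eta+4\lambda+4\xi-12\pi\zeta>0 .$$ Then the inequality $W\ge 0$ is stable, that is, both $h_1$-stable and $h_2$-stable: for each $k\in\{1,2\}$ there is a constant $C>0$,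 depending only on the parameters, such that $h_k(K,S(K))^2\le C\,W$ for every such domain $K$. -/

import Mathlib

open Real MeasureTheory
open scoped ContDiff

noncomputable section

namespace ParametricIsoperimetric

/-- The Euclidean plane. -/
abbrev Plane : Type := EuclideanSpace ℝ (Fin 2)

/-! ### Plane curves -/

/-- The determinant `v₁ w₂ - v₂ w₁` of two vectors of the plane. -/
def cross (v w : Plane) : ℝ := v 0 * w 1 - v 1 * w 0

/-- The signed curvature `(c₁' c₂'' - c₂' c₁'') / (c₁'² + c₂'²)^(3/2)` of a parametrized curve. -/
def curvature (c : ℝ → Plane) (t : ℝ) : ℝ :=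
  cross (deriv c t) (deriv (deriv c) t) / ‖deriv c t‖ ^ 3

/-- The length of one turn of a `2π`-periodic curve. -/
def curveLength (c : ℝ → Plane) : ℝ := ∫ θ in (0 : ℝ)..2 * π, ‖deriv c θ‖

/-- The oriented area `(1/2) ∮ c₁ dc₂ - c₂ dc₁` enclosed by a `2π`-periodic curve. -/
def orientedArea (c : ℝ → Plane) : ℝ :=
  (1 / 2) * ∫ θ in (0 : ℝ)..2 * π, cross (c θ) (deriv c θ)

/-! ### Convex domains -/

/-- `K` is a closed (bounded), strictly convex plane domain whose boundary is a smooth regular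
simple closed curve with positive curvature (for the counterclockwise orientation). -/
structure IsSmoothStrictlyConvexDomain (K : Set Plane) : Prop where
  isCompact : IsCompact K
  strictConvex : StrictConvex ℝ K
  interior_nonempty : (interior K).Nonempty
  exists_boundary_curve : ∃ (T : ℝ) (c : ℝ → Plane), 0 < T ∧ ContDiff ℝ ∞ c ∧
    Function.Periodic c T ∧ Set.InjOn c (Set.Ico 0 T) ∧ Set.range c = frontier K ∧
    (∀ t, deriv c t ≠ 0) ∧ ∀ t, 0 < curvature c t

/-- The unit vector `(cos θ, sin θ)`. -/
def unitVec (θ : ℝ) : Plane := !₂[cos θ, sin θ]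

/-- The unit vector `(-sin θ, cos θ)`. -/
def unitTan (θ : ℝ) : Plane := !₂[-sin θ, cos θ]

/-- The support function `p_K(θ) = max_{x ∈ K} ⟨x, (cos θ, sin θ)⟩`. -/
def supportFun (K : Set Plane) (θ : ℝ) : ℝ := sSup ((fun x => inner ℝ x (unitVec θ)) '' K)

/-- The boundary curve of `K`, parametrized by the angle `θ` between the `x`-axis and the outward
normal: `γ = (p cos θ - p' sin θ, p sin θ + p' cos θ)`. -/
def boundaryCurve (K : Set Plane) (θ : ℝ) : Plane :=
  supportFun K θ • unitVec θ + deriv (supportFun K) θ • unitTan θ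

/-- The curvature `κ(θ)` of the boundary curve. -/
def kappa (K : Set Plane) (θ : ℝ) : ℝ := curvature (boundaryCurve K) θ

/-- The curvature radius `ρ(θ) = 1 / κ(θ)` of the boundary curve. -/
def rho (K : Set Plane) (θ : ℝ) : ℝ := 1 / kappa K θ

/-- The locus of curvature centers `β = γ + ρ N`, with `N = -(cos θ, sin θ)` the inward normal. -/
def centersLocus (K : Set Plane) (θ : ℝ) : Plane :=
  boundaryCurve K θ + rho K θ • (-unitVec θ)

/-- The curvature radius `ρ_β = |1 / κ_β|` of the locus of curvature centers. It equals
`|p' + p'''|` everywhere: at the cusps of `β`, where `β' = 0`, the quotient has the value `0`. -/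
def rhoBeta (K : Set Plane) (θ : ℝ) : ℝ := |1 / curvature (centersLocus K) θ|

/-- The length `L` of the boundary curve. -/
def perimeter (K : Set Plane) : ℝ := curveLength (boundaryCurve K)

/-- The area `A` of `K`. -/
def area (K : Set Plane) : ℝ := (volume : Measure Plane).real K

/-- The oriented area of the domain enclosed by the locus of curvature centers. -/
def centersArea (K : Set Plane) : ℝ := orientedArea (centersLocus K)

/-- The circumradius `ρ_e`: the radius of the smallest disk that contains `K`. -/
def circumradius (K : Set Plane) : ℝ :=
  sInf {r : ℝ | 0 ≤ r ∧ ∃ x : Plane, K ⊆ Metric.closedBall x r}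

/-- The inradius `ρ_i`: the radius of the largest disk contained in `K`. -/
def inradius (K : Set Plane) : ℝ :=
  sSup {r : ℝ | 0 ≤ r ∧ ∃ x : Plane, Metric.closedBall x r ⊆ K}

/-- The maximum `ρ_M` of the curvature radius. -/
def rhoMax (K : Set Plane) : ℝ := sSup (rho K '' Set.Icc 0 (2 * π))

/-- The minimum `ρ_m` of the curvature radius. -/
def rhoMin (K : Set Plane) : ℝ := sInf (rho K '' Set.Icc 0 (2 * π))

/-- The integral `∮ κ² ds` along the boundary curve. -/
def curvatureEnergy (K : Set Plane) : ℝ :=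
  ∫ θ in (0 : ℝ)..2 * π, kappa K θ ^ 2 * ‖deriv (boundaryCurve K) θ‖

/-! ### Distances and the Steiner disk -/

/-- `h₁(K, K') = max_{θ ∈ [0, 2π]} |p_K(θ) - p_{K'}(θ)|`. -/
def h1 (K K' : Set Plane) : ℝ :=
  sSup ((fun θ => |supportFun K θ - supportFun K' θ|) '' Set.Icc 0 (2 * π))

/-- `h₂(K, K') = (∫₀^{2π} |p_K(θ) - p_{K'}(θ)|² dθ)^{1/2}`. -/
def h2 (K K' : Set Plane) : ℝ :=
  √(∫ θ in (0 : ℝ)..2 * π, |supportFun K θ - supportFun K' θ| ^ 2)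

/-- The Steiner point `(1/π) ∫₀^{2π} p_K(θ) (cos θ, sin θ) dθ`. -/
def steinerPoint (K : Set Plane) : Plane :=
  (1 / π) • ∫ θ in (0 : ℝ)..2 * π, supportFun K θ • unitVec θ

/-- The Steiner disk: centre the Steiner point, radius `L / (2π)`. -/
def steinerDisk (K : Set Plane) : Set Plane :=
  Metric.closedBall (steinerPoint K) (perimeter K / (2 * π))

/-! ### The parametric inequality and its stability -/

/-- A parameter set `(α, δ, μ, σ, η, λ, ξ, ζ)`; the field `lam` is `λ`. -/
structure ParameterSet where
  (α δ μ σ η lam ξ ζ : ℝ)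

/-- The condition on the parameters under which stability is claimed. -/
def ParameterSet.StabilityCondition (P : ParameterSet) : Prop :=
  (0 ≤ P.η ∧ 0 ≤ P.ξ ∧ 0 ≤ P.ζ) ∧
  P.lam ≤ 0 ∧
  0 ≤ 2 * P.α + 4 * π * P.δ + P.μ - 4 * P.ζ ∧
  0 ≤ 2 * P.α + P.σ - 2 * P.η - 4 * P.ζ ∧
  0 < 6 * π * P.α - π * P.μ + 4 * π * P.σ + 24 * π * P.η + 4 * P.lam + 4 * P.ξ - 12 * π * P.ζ

/-- The quantity `W` of the domain `K`, for the parameter set `P`. -/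
def W (P : ParameterSet) (K : Set Plane) : ℝ :=
  P.α * (∫ θ in (0 : ℝ)..2 * π, rho K θ ^ 2)
    + P.δ * perimeter K ^ 2
    + P.μ * area K
    + P.σ * |centersArea K|
    + P.η * (∫ θ in (0 : ℝ)..2 * π, rhoBeta K θ ^ 2)
    + P.lam * (circumradius K - inradius K) ^ 2
    + P.ξ * (rhoMax K - rhoMin K) ^ 2
    + P.ζ * curvatureEnergy K

/-- Stability of `W ≥ 0` with respect to a distance `h`: for some positive constant `C`, which
depends only on the parameter set, `h(K, S(K))² ≤ C W` for all domains `K`. -/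
def StableFor (h : Set Plane → Set Plane → ℝ) (P : ParameterSet) : Prop :=
  ∃ C : ℝ, 0 < C ∧ ∀ K : Set Plane, IsSmoothStrictlyConvexDomain K →
    h K (steinerDisk K) ^ 2 ≤ C * W P K

/-- The inequality `W ≥ 0` is stable: it is both `h₁`-stable and `h₂`-stable. -/
def IsStable (P : ParameterSet) : Prop := StableFor h1 P ∧ StableFor h2 P

end ParametricIsoperimetric

end

noncomputable section

namespace ParametricIsoperimetric

/-! ### Integral inequalities for periodic functions -/

/-! Everything is expressed through the difference `f` of the support functions of `K` and `S(K)`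
(`deviation`) and the numbers `b_j`, the integrals over one period of the squared `j`-th derivative
of `f`. The centre and radius of the Steiner disk are exactly what removes the Fourier modes of
order `0` and `±1` from `f` (`hasNoLowModes_deviation`).

Put `d = b₁ - b₀`. Integration by parts gives `L²/(2π) - 2A = d`, `∫ρ² = L²/(2π) + b₀ - 2b₁ + b₂`,
`2Ã = b₁ - b₂` and `∫ρ_β² = b₁ - 2b₂ + b₃`. Only modes with `n² ≥ 4` occur, so Parseval yields `b₂ -
b₁ ≥ 4d` and `b₃ - b₂ ≥ 4(b₂ - b₁)`. Bonnesen's inequality `π(ρ_e - ρ_i)² ≤ 2d` handles the term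
with `λ ≤ 0`, and Popoviciu's inequality gives `2d ≤ π(ρ_M - ρ_m)²` for the term with `ξ ≥ 0`. Of
the curvature energy only the sign is used. Added with weights, these give `κ d ≤ 2πW`, where `κ >
0` is the last expression in the hypotheses (`deficit_le_W`). Finally both squared distances are at
most `3πd`, by Wirtinger for `h₂` and by a Sobolev inequality for `h₁`.

The geometric input is threefold. The support function is smooth because positive curvature allows
the tangent angle to be inverted locally (`contDiff_supportFun`). The area is `½∫pρ`, by polar
coordinates adapted to the boundary (`area_eq`). Bonnesen's inequality follows from Wirtinger's
inequality between contact points of `K` with its incircle and with its circumcircle. -/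

/-- Wirtinger's inequality with Dirichlet boundary conditions on an interval of length at most
`π`. -/
lemma integral_sq_le_integral_deriv_sq_of_zero {q q' : ℝ → ℝ} {a b : ℝ} (hab : a ≤ b)
    (hlen : b - a ≤ π) (hq : ∀ x, HasDerivAt q (q' x) x) (hq' : Continuous q')
    (ha : q a = 0) (hb : q b = 0) :
    ∫ x in a..b, q x ^ 2 ≤ ∫ x in a..b, q' x ^ 2 := by
  have hqc : Continuous q := continuous_iff_continuousAt.2 fun x => (hq x).continuousAt
  -- A frequency `l < 1` keeps `l * (x - m)` strictly inside `(-π/2, π/2)`, so the tangent has no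
  -- pole even on an interval of length exactly `π`; the limit `l → 1` is taken at the end.
  have key : ∀ l : ℝ, 0 < l → l < 1 →
      l ^ 2 * (∫ x in a..b, q x ^ 2) ≤ ∫ x in a..b, q' x ^ 2 := by
    intro l hl hl1
    set m := (a + b) / 2
    have hcos : ∀ x ∈ Set.Icc a b, cos (l * (x - m)) ≠ 0 := by
      intro x hx
      have hm : |x - m| ≤ π / 2 := by
        rw [abs_le]; constructor <;> simp only [m] <;> linarith [hx.1, hx.2]
      have h2 : |l * (x - m)| < π / 2 := by
        rw [abs_mul, abs_of_pos hl]
        nlinarith [pi_pos, abs_nonneg (x - m)]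
      rw [abs_lt] at h2
      exact (cos_pos_of_mem_Ioo ⟨by linarith [h2.1], h2.2⟩).ne'
    have hder : ∀ x ∈ Set.Icc a b, HasDerivAt (fun x => -(l * (q x ^ 2 * tan (l * (x - m)))))
        (-(l * (2 * q x * q' x * tan (l * (x - m))
          + q x ^ 2 * (l * (1 + tan (l * (x - m)) ^ 2))))) x := by
      intro x hx
      have h1 : HasDerivAt (fun x => l * (x - m)) l x := by
        simpa using ((hasDerivAt_id x).sub_const m).const_mul l
      have h2 := (hasDerivAt_tan (hcos x hx)).comp x h1
      have h3 := ((((hq x).pow 2).mul h2).const_mul l).neg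
      refine h3.congr_deriv ?_
      have := hcos x hx
      have hc : 1 / cos (l * (x - m)) ^ 2 = 1 + tan (l * (x - m)) ^ 2 := by
        rw [tan_eq_sin_div_cos]; field_simp
        linarith [sin_sq_add_cos_sq (l * (x - m))]
      rw [hc]
      simp only [Function.comp, Pi.pow_apply]
      push_cast
      ring
    -- Picone's identity: `q'² - l²q²` exceeds the derivative of `-l q² tan` by the square of `q' +
    -- l q tan`.
    have hI := intervalIntegral.sub_le_integral_of_hasDeriv_right_of_le
      (φ := fun x => q' x ^ 2 - l ^ 2 * q x ^ 2) hab
      (fun x hx => (hder x hx).continuousAt.continuousWithinAt)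
      (fun x hx => (hder x (Set.Ioo_subset_Icc_self hx)).hasDerivWithinAt)
      ((by fun_prop : Continuous fun x => q' x ^ 2 - l ^ 2 * q x ^ 2).continuousOn.integrableOn_Icc)
      (fun x hx => by nlinarith [sq_nonneg (q' x + l * q x * tan (l * (x - m)))])
    rw [intervalIntegral.integral_sub (by apply Continuous.intervalIntegrable; fun_prop)
      (by apply Continuous.intervalIntegrable; fun_prop),
      intervalIntegral.integral_const_mul, ha, hb] at hI
    simp at hI
    linarith
  have hlim : Filter.Tendsto (fun l : ℝ => l ^ 2 * (∫ x in a..b, q x ^ 2)) (nhdsWithin 1 (Set.Iio 1))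
      (nhds (1 ^ 2 * (∫ x in a..b, q x ^ 2))) :=
    (Continuous.tendsto (by fun_prop) 1).mono_left nhdsWithin_le_nhds
  rw [one_pow, one_mul] at hlim
  refine le_of_tendsto hlim ?_
  filter_upwards [Ioo_mem_nhdsLT (show (0 : ℝ) < 1 by norm_num)] with l hl
  exact key l hl.1 hl.2

/-- If a nonnegative `2π`-periodic function cannot be made uniformly positive by subtracting a
multiple of a translate of the cosine, then it vanishes somewhere on each closed arc of
length `π`. -/
lemma exists_zero_of_not_movable {q : ℝ → ℝ} (hq : Continuous q)
    (hper : Function.Periodic q (2 * π)) (hnn : ∀ θ, 0 ≤ q θ)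
    (hmov : ∀ φ s ε : ℝ, 0 < s → 0 < ε → ∃ θ, q θ - s * cos (θ - φ) < ε) (t : ℝ) :
    ∃ z ∈ Set.Icc t (t + π), q z = 0 := by
  by_contra! hne
  obtain ⟨z, hz, hzmin⟩ := (isCompact_Icc (a := t) (b := t + π)).exists_isMinOn
    ⟨t, by simp [pi_pos.le]⟩ hq.continuousOn
  have he : 0 < q z := lt_of_le_of_ne (hnn z) (hne z hz).symm
  -- The cosine peaks at the midpoint of the arc: on the arc at most half of the minimum `q z` is
  -- lost, and on the open complementary arc the cosine is negative.
  set g : ℝ → ℝ := fun θ => q θ - q z / 2 * cos (θ - (t + π / 2))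
  have hg : Continuous g := by fun_prop
  have hgper : Function.Periodic g (2 * π) := by
    intro θ
    simp only [g]
    rw [hper θ, show θ + 2 * π - (t + π / 2) = θ - (t + π / 2) + 2 * π by ring, cos_add_two_pi]
  have hgpos : ∀ θ ∈ Set.Icc t (t + 2 * π), 0 < g θ := by
    intro θ hθ
    have hc := cos_le_one (θ - (t + π / 2))
    rcases le_or_gt θ (t + π) with h | h
    · have : q z ≤ q θ := hzmin ⟨hθ.1, h⟩
      simp only [g]; nlinarith
    · rcases eq_or_lt_of_le hθ.2 with h' | h'
      · have : q z ≤ q t := hzmin ⟨le_rfl, by linarith [pi_pos]⟩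
        have h3 : q θ = q t := by rw [h', hper t]
        simp only [g]; nlinarith
      · have : cos (θ - (t + π / 2)) < 0 :=
          cos_neg_of_pi_div_two_lt_of_lt (by linarith) (by linarith)
        simp only [g]; nlinarith [hnn θ]
  obtain ⟨w, hw, hwmin⟩ := (isCompact_Icc (a := t) (b := t + 2 * π)).exists_isMinOn
    ⟨t, by simp [pi_pos.le]⟩ hg.continuousOn
  obtain ⟨θ, hθ⟩ := hmov (t + π / 2) (q z / 2) (g w) (by linarith) (hgpos w hw)
  obtain ⟨y, hy, hxy⟩ := hgper.exists_mem_Ico two_pi_pos θ t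
  have h1 : g w ≤ g y := hwmin (Set.Ico_subset_Icc_self hy)
  have h2 : g θ < g w := hθ
  linarith

/-- Wirtinger's inequality for a periodic function that vanishes somewhere on each closed arc of
length `π`. -/
lemma integral_sq_le_integral_deriv_sq_of_zero_on_arcs {q q' : ℝ → ℝ}
    (hq : ∀ x, HasDerivAt q (q' x) x) (hq' : Continuous q')
    (hper : Function.Periodic q (2 * π)) (hper' : Function.Periodic q' (2 * π))
    (hz : ∀ t, ∃ z ∈ Set.Icc t (t + π), q z = 0) :
    ∫ x in (0 : ℝ)..2 * π, q x ^ 2 ≤ ∫ x in (0 : ℝ)..2 * π, q' x ^ 2 := by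
  have hqc : Continuous q := continuous_iff_continuousAt.2 fun x => (hq x).continuousAt
  have hcl : IsClosed {x | q x = 0} := isClosed_eq hqc continuous_const
  obtain ⟨z₀, -, h₀⟩ := hz 0
  obtain ⟨z₁, ⟨⟨h₁l, h₁u⟩, h₁⟩, h₁g⟩ :=
    ((isCompact_Icc (a := z₀) (b := z₀ + π)).inter_right hcl).exists_isGreatest
      ⟨z₀, ⟨le_rfl, by linarith [pi_pos]⟩, h₀⟩
  obtain ⟨y, hy, hy0⟩ := hz (z₀ + π)
  obtain ⟨z₂, ⟨⟨h₂l, h₂u⟩, h₂⟩, h₂g⟩ :=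
    ((isCompact_Icc (a := z₀ + π) (b := z₀ + π + π)).inter_right hcl).exists_isLeast
      ⟨y, hy, hy0⟩
  -- A longer gap would contain a closed arc of length `π`, centred at the midpoint of `z₁` and
  -- `z₂`, without zeros.
  have h12 : z₂ - z₁ ≤ π := by
    by_contra! hlt
    obtain ⟨z, ⟨hzl, hzu⟩, hz0⟩ := hz ((z₁ + z₂ - π) / 2)
    rcases le_total z (z₀ + π) with h | h
    · have : z ≤ z₁ := h₁g ⟨⟨by linarith, h⟩, hz0⟩
      linarith
    · have : z₂ ≤ z := h₂g ⟨⟨h, by linarith⟩, hz0⟩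
      linarith
  have h3 : q (z₀ + 2 * π) = 0 := by rw [hper z₀]; exact h₀
  have hP : Function.Periodic (fun x => q x ^ 2) (2 * π) := fun x => by simp only [hper x]
  have hP' : Function.Periodic (fun x => q' x ^ 2) (2 * π) := fun x => by simp only [hper' x]
  have e1 := hP.intervalIntegral_add_eq 0 z₀
  have e2 := hP'.intervalIntegral_add_eq 0 z₀
  rw [zero_add] at e1 e2
  rw [e1, e2]
  have I1 : ∀ u v : ℝ, IntervalIntegrable (fun x => q x ^ 2) volume u v :=
    fun u v => (hqc.pow 2).intervalIntegrable u v
  have I2 : ∀ u v : ℝ, IntervalIntegrable (fun x => q' x ^ 2) volume u v :=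
    fun u v => (hq'.pow 2).intervalIntegrable u v
  rw [← intervalIntegral.integral_add_adjacent_intervals (I1 z₀ z₁) (I1 z₁ _),
    ← intervalIntegral.integral_add_adjacent_intervals (I1 z₁ z₂) (I1 z₂ _),
    ← intervalIntegral.integral_add_adjacent_intervals (I2 z₀ z₁) (I2 z₁ _),
    ← intervalIntegral.integral_add_adjacent_intervals (I2 z₁ z₂) (I2 z₂ _)]
  have j1 := integral_sq_le_integral_deriv_sq_of_zero h₁l (by linarith) hq hq' h₀ h₁
  have j2 := integral_sq_le_integral_deriv_sq_of_zero (by linarith) h12 hq hq' h₁ h₂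
  have j3 := integral_sq_le_integral_deriv_sq_of_zero (b := z₀ + 2 * π) (by linarith)
    (by linarith) hq hq' h₂ h3
  linarith

/-- A Sobolev inequality: a function with mean value zero is bounded by the `L²` norm of its
derivative. -/
lemma sq_le_integral_deriv_sq_of_integral_eq_zero {f f' : ℝ → ℝ}
    (hf : ∀ x, HasDerivAt f (f' x) x) (hf' : Continuous f')
    (h0 : ∫ x in (0 : ℝ)..2 * π, f x = 0) {x : ℝ} (hx : x ∈ Set.Icc 0 (2 * π)) :
    f x ^ 2 ≤ 2 * π * ∫ t in (0 : ℝ)..2 * π, f' t ^ 2 := by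
  have hfc : Continuous f := continuous_iff_continuousAt.2 fun x => (hf x).continuousAt
  have hF : ∀ u, HasDerivAt (fun u => ∫ t in (0 : ℝ)..u, f t) (f u) u := fun u =>
    intervalIntegral.integral_hasDerivAt_right (hfc.intervalIntegrable _ _)
      hfc.stronglyMeasurable.stronglyMeasurableAtFilter hfc.continuousAt
  -- Rolle's theorem for the primitive of `f`: mean value zero forces a zero of `f`.
  obtain ⟨y, hy, hy0⟩ := exists_hasDerivAt_eq_zero two_pi_pos
    (fun u _ => (hF u).continuousAt.continuousWithinAt) (by simp [h0]) (fun u _ => hF u)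
  have hsub : f x = ∫ t in y..x, f' t := by
    rw [intervalIntegral.integral_eq_sub_of_hasDerivAt (fun u _ => hf u)
      (hf'.intervalIntegrable _ _), hy0, sub_zero]
  set M := ∫ t in (0 : ℝ)..2 * π, |f' t|
  have h1 : |f x| ≤ M := by
    rw [hsub]
    refine (intervalIntegral.norm_integral_le_integral_norm_uIoc (f := f')).trans ?_
    simp only [M, norm_eq_abs]
    rw [intervalIntegral.integral_of_le two_pi_pos.le]
    refine setIntegral_mono_set ?_ (Filter.Eventually.of_forall fun t => abs_nonneg _) ?_
    · exact (hf'.abs.integrableOn_Icc).mono_set Set.Ioc_subset_Icc_self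
    · refine LE.le.eventuallyLE ?_
      rw [Set.uIoc]
      exact Set.Ioc_subset_Ioc (le_min hy.1.le hx.1) (max_le hy.2.le hx.2)
  -- Cauchy–Schwarz, written as nonnegativity of the variance of `|f'|`.
  have hCS : 0 ≤ ∫ t in (0 : ℝ)..2 * π, (|f' t| - M / (2 * π)) ^ 2 :=
    intervalIntegral.integral_nonneg two_pi_pos.le fun t _ => sq_nonneg _
  have hexp : ∫ t in (0 : ℝ)..2 * π, (|f' t| - M / (2 * π)) ^ 2
      = (∫ t in (0 : ℝ)..2 * π, f' t ^ 2) - M ^ 2 / (2 * π) := by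
    have : ∀ t, (|f' t| - M / (2 * π)) ^ 2
        = f' t ^ 2 - (2 * (M / (2 * π)) * |f' t| - (M / (2 * π)) ^ 2) := by
      intro t; rw [← sq_abs (f' t)]; ring
    simp_rw [this]
    rw [intervalIntegral.integral_sub (by apply Continuous.intervalIntegrable; fun_prop)
        (by apply Continuous.intervalIntegrable; fun_prop),
      intervalIntegral.integral_sub (by apply Continuous.intervalIntegrable; fun_prop)
        (by simp), intervalIntegral.integral_const_mul, intervalIntegral.integral_const]
    simp only [smul_eq_mul, sub_zero]
    have := pi_pos.ne'
    change _ - (2 * (M / (2 * π)) * M - _) = _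
    field_simp
    ring
  rw [hexp] at hCS
  have h2 : M ^ 2 ≤ 2 * π * ∫ t in (0 : ℝ)..2 * π, f' t ^ 2 := by
    rw [sub_nonneg, div_le_iff₀ two_pi_pos] at hCS
    linarith
  calc f x ^ 2 = |f x| ^ 2 := (sq_abs _).symm
    _ ≤ M ^ 2 := pow_le_pow_left₀ (abs_nonneg _) h1 2
    _ ≤ _ := h2

/-! ### Fourier coefficients and Wirtinger inequalities -/

/-- The Fourier coefficients of a real function on `[0, 2π]`. -/
def coeff (f : ℝ → ℝ) (n : ℤ) : ℂ :=
  fourierCoeffOn two_pi_pos (fun x => (f x : ℂ)) n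

lemma hasSum_norm_coeff_sq {f : ℝ → ℝ} (hf : Continuous f) :
    HasSum (fun n => ‖coeff f n‖ ^ 2) ((2 * π)⁻¹ * ∫ x in (0 : ℝ)..2 * π, f x ^ 2) := by
  have hc : Continuous fun x => (f x : ℂ) := Complex.continuous_ofReal.comp hf
  have hL : MemLp (fun x => (f x : ℂ)) 2 (volume.restrict (Set.Ioc 0 (2 * π))) := by
    obtain ⟨C, hC⟩ := (isCompact_Icc (a := (0 : ℝ)) (b := 2 * π)).exists_bound_of_continuousOn
      hc.continuousOn
    refine MemLp.of_bound hc.aestronglyMeasurable C ?_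
    filter_upwards [ae_restrict_mem measurableSet_Ioc] with x hx
    exact hC x (Set.Ioc_subset_Icc_self hx)
  have := hasSum_sq_fourierCoeffOn two_pi_pos hL
  simpa [coeff] using this

/-- Integration by parts multiplies the `n`-th coefficient by `i n`; for `n = 0` this says that the
derivative of a periodic function has mean zero. -/
lemma norm_coeff_deriv_sq {f f' : ℝ → ℝ} (hf : ∀ x, HasDerivAt f (f' x) x) (hf' : Continuous f')
    (hper : f (2 * π) = f 0) (n : ℤ) : ‖coeff f' n‖ ^ 2 = (n : ℝ) ^ 2 * ‖coeff f n‖ ^ 2 := by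
  have hc' : Continuous fun x => (f' x : ℂ) := Complex.continuous_ofReal.comp hf'
  rcases eq_or_ne n 0 with rfl | hn
  · have : coeff f' 0 = 0 := by
      rw [coeff, fourierCoeffOn_eq_integral]
      simp only [neg_zero, fourier_zero, one_smul]
      rw [intervalIntegral.integral_ofReal, intervalIntegral.integral_eq_sub_of_hasDerivAt
        (fun x _ => hf x) (hf'.intervalIntegrable _ _), hper]
      simp
    simp [this]
  · have h := fourierCoeffOn_of_hasDerivAt two_pi_pos (f := fun x => (f x : ℂ))
      (f' := fun x => (f' x : ℂ)) hn (fun x _ => (hf x).ofReal_comp)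
      (hc'.intervalIntegrable _ _)
    have h2 : coeff f' n = Complex.I * n * coeff f n := by
      rw [coeff, coeff, h, hper]
      have : (n : ℂ) ≠ 0 := by exact_mod_cast hn
      have hpi : (π : ℂ) ≠ 0 := by exact_mod_cast pi_pos.ne'
      push_cast
      field_simp [Complex.I_ne_zero]
      ring
    rw [h2, norm_mul, norm_mul]
    simp only [Complex.norm_I, one_mul, Complex.norm_intCast, mul_pow, sq_abs]

lemma coeff_eq_zero {f : ℝ → ℝ} (hf : Continuous f) (n : ℤ)
    (hc : ∫ x in (0 : ℝ)..2 * π, f x * cos (n * x) = 0)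
    (hs : ∫ x in (0 : ℝ)..2 * π, f x * sin (n * x) = 0) : coeff f n = 0 := by
  rw [coeff, fourierCoeffOn_eq_integral]
  have : ∀ x : ℝ, (fourier (-n) (x : AddCircle (2 * π - 0)) : ℂ) • (f x : ℂ)
      = ((f x * cos (n * x) : ℝ) : ℂ) - ((f x * sin (n * x) : ℝ) : ℂ) * Complex.I := by
    intro x
    rw [fourier_coe_apply]
    have hpi : (π : ℂ) ≠ 0 := by exact_mod_cast pi_pos.ne'
    have : (2 * π * Complex.I * ((-n : ℤ) : ℂ) * x / ((2 * π - 0 : ℝ) : ℂ))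
        = ((-(n * x) : ℝ) : ℂ) * Complex.I := by
      push_cast; field_simp; ring
    rw [this, Complex.exp_mul_I, ← Complex.ofReal_cos, ← Complex.ofReal_sin, cos_neg, sin_neg,
      smul_eq_mul]
    push_cast
    ring
  simp_rw [this]
  rw [intervalIntegral.integral_sub (by apply Continuous.intervalIntegrable; fun_prop)
      (by apply Continuous.intervalIntegrable; fun_prop), intervalIntegral.integral_mul_const,
    intervalIntegral.integral_ofReal, intervalIntegral.integral_ofReal, hc, hs]
  simp

/-- A function on `[0, 2π]` has no Fourier modes of order `0` and `1`. -/
structure HasNoLowModes (f : ℝ → ℝ) : Prop where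
  integral_eq_zero : ∫ x in (0 : ℝ)..2 * π, f x = 0
  integral_cos : ∫ x in (0 : ℝ)..2 * π, f x * cos x = 0
  integral_sin : ∫ x in (0 : ℝ)..2 * π, f x * sin x = 0

lemma HasNoLowModes.coeff_eq_zero_or {f : ℝ → ℝ} (h : HasNoLowModes f) (hf : Continuous f)
    (n : ℤ) : coeff f n = 0 ∨ 4 ≤ (n : ℝ) ^ 2 := by
  rcases lt_or_ge |n| 2 with hn | hn
  · left
    have h3 : n = -1 ∨ n = 0 ∨ n = 1 := by rw [abs_lt] at hn; omega
    rcases h3 with rfl | rfl | rfl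
    · apply coeff_eq_zero hf
      · simpa using h.integral_cos
      · simpa using h.integral_sin
    · apply coeff_eq_zero hf
      · simpa using h.integral_eq_zero
      · simp
    · apply coeff_eq_zero hf
      · simpa using h.integral_cos
      · simpa using h.integral_sin
  · right
    have : (2 : ℝ) ≤ |(n : ℝ)| := by exact_mod_cast hn
    rw [← sq_abs]
    nlinarith

/-- Wirtinger's inequality in the absence of the Fourier modes of order `0` and `1`. -/
lemma HasNoLowModes.four_mul_integral_sq_le {f f' : ℝ → ℝ} (h : HasNoLowModes f)
    (hf : ∀ x, HasDerivAt f (f' x) x) (hf' : Continuous f') (hper : f (2 * π) = f 0) :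
    4 * (∫ x in (0 : ℝ)..2 * π, f x ^ 2) ≤ ∫ x in (0 : ℝ)..2 * π, f' x ^ 2 := by
  have hfc : Continuous f := continuous_iff_continuousAt.2 fun x => (hf x).continuousAt
  have h0 := (hasSum_norm_coeff_sq hfc).mul_left 4
  have h1 := hasSum_norm_coeff_sq hf'
  have := hasSum_le (fun n => ?_) h0 h1
  · have hpos : 0 < (2 * π)⁻¹ := inv_pos.2 two_pi_pos
    nlinarith
  · rw [norm_coeff_deriv_sq hf hf' hper]
    rcases h.coeff_eq_zero_or hfc n with h | h
    · simp [h]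
    · exact mul_le_mul_of_nonneg_right h (sq_nonneg _)

/-- The second order Wirtinger inequality: `∫ (f'' + f) (f'' + 4 f) ≥ 0` in the absence of the
Fourier modes of order `0` and `1`. -/
lemma HasNoLowModes.five_mul_integral_deriv_sq_le {f f' f'' : ℝ → ℝ} (h : HasNoLowModes f)
    (hf : ∀ x, HasDerivAt f (f' x) x) (hf' : ∀ x, HasDerivAt f' (f'' x) x)
    (hf'' : Continuous f'') (hper : f (2 * π) = f 0) (hper' : f' (2 * π) = f' 0) :
    5 * (∫ x in (0 : ℝ)..2 * π, f' x ^ 2) ≤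
      (∫ x in (0 : ℝ)..2 * π, f'' x ^ 2) + 4 * ∫ x in (0 : ℝ)..2 * π, f x ^ 2 := by
  have hfc : Continuous f := continuous_iff_continuousAt.2 fun x => (hf x).continuousAt
  have hfc' : Continuous f' := continuous_iff_continuousAt.2 fun x => (hf' x).continuousAt
  have h0 := (hasSum_norm_coeff_sq hfc).mul_left 4
  have h1 := (hasSum_norm_coeff_sq hfc').mul_left 5
  have h2 := hasSum_norm_coeff_sq hf''
  have := hasSum_le (fun n => ?_) h1 (h2.add h0)
  · have hpos : 0 < (2 * π)⁻¹ := inv_pos.2 two_pi_pos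
    nlinarith
  · rw [norm_coeff_deriv_sq hf' hf'' hper', norm_coeff_deriv_sq hf hfc' hper]
    rcases h.coeff_eq_zero_or hfc n with h | h
    · simp [h]
    -- Mode by mode the claim is `(n² - 4)(n² - 1) ≥ 0`.
    · nlinarith [mul_nonneg (mul_nonneg (sub_nonneg.2 h) (by linarith : (0 : ℝ) ≤ (n : ℝ) ^ 2 - 1))
        (sq_nonneg ‖coeff f n‖)]

/-! ### Unit vectors -/

@[simp] lemma unitVec_zero (θ : ℝ) : unitVec θ 0 = cos θ := rfl
@[simp] lemma unitVec_one (θ : ℝ) : unitVec θ 1 = sin θ := rfl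
@[simp] lemma unitTan_zero (θ : ℝ) : unitTan θ 0 = -sin θ := rfl
@[simp] lemma unitTan_one (θ : ℝ) : unitTan θ 1 = cos θ := rfl

lemma inner_eq (x y : Plane) : inner ℝ x y = x 0 * y 0 + x 1 * y 1 := by
  simp [PiLp.inner_apply, mul_comm]

lemma inner_unitVec (x : Plane) (θ : ℝ) : inner ℝ x (unitVec θ) = x 0 * cos θ + x 1 * sin θ := by
  simp [inner_eq]

lemma inner_unitTan (x : Plane) (θ : ℝ) :
    inner ℝ x (unitTan θ) = -(x 0 * sin θ) + x 1 * cos θ := by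
  simp [inner_eq]

lemma norm_eq (x : Plane) : ‖x‖ = √(x 0 ^ 2 + x 1 ^ 2) := by
  simp [EuclideanSpace.norm_eq]

lemma norm_unitVec (θ : ℝ) : ‖unitVec θ‖ = 1 := by simp [norm_eq]

lemma norm_unitTan (θ : ℝ) : ‖unitTan θ‖ = 1 := by simp [norm_eq]

lemma plane_ext {x y : Plane} (h0 : x 0 = y 0) (h1 : x 1 = y 1) : x = y := by
  ext i; fin_cases i <;> assumption

lemma exists_eq_smul_unitVec (v : Plane) : ∃ θ, v = ‖v‖ • unitVec θ := by
  refine ⟨Complex.arg ⟨v 0, v 1⟩, ?_⟩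
  have hn : ‖v‖ = ‖(⟨v 0, v 1⟩ : ℂ)‖ := by
    rw [norm_eq, Complex.norm_def, Complex.normSq_mk]; ring_nf
  apply plane_ext
  · simp only [PiLp.smul_apply, unitVec_zero, smul_eq_mul, hn, Complex.norm_mul_cos_arg]
  · simp only [PiLp.smul_apply, unitVec_one, smul_eq_mul, hn, Complex.norm_mul_sin_arg]

lemma eq_inner_smul_add (v : Plane) (θ : ℝ) :
    v = inner ℝ v (unitVec θ) • unitVec θ + inner ℝ v (unitTan θ) • unitTan θ := by
  have := sin_sq_add_cos_sq θ
  apply plane_ext <;> simp only [PiLp.smul_apply, PiLp.add_apply, smul_eq_mul, unitVec_zero,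
    unitVec_one, unitTan_zero, unitTan_one, inner_unitVec, inner_unitTan]
  · linear_combination (-v 0) * this
  · linear_combination (-v 1) * this

lemma hasDerivAt_inner_unitVec (x : Plane) (θ : ℝ) :
    HasDerivAt (fun θ => inner ℝ x (unitVec θ)) (inner ℝ x (unitTan θ)) θ := by
  simp only [inner_unitVec, inner_unitTan]
  exact (((hasDerivAt_cos θ).const_mul (x 0)).add ((hasDerivAt_sin θ).const_mul (x 1))).congr_deriv
    (by ring)

lemma hasDerivAt_inner_unitTan (x : Plane) (θ : ℝ) :
    HasDerivAt (fun θ => inner ℝ x (unitTan θ)) (-inner ℝ x (unitVec θ)) θ := by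
  simp only [inner_unitVec, inner_unitTan]
  exact ((((hasDerivAt_sin θ).const_mul (x 0)).neg).add
    ((hasDerivAt_cos θ).const_mul (x 1))).congr_deriv (by ring)

lemma continuous_inner_unitVec (x : Plane) : Continuous fun θ => inner ℝ x (unitVec θ) := by
  simp only [inner_unitVec]; fun_prop

lemma continuous_inner_unitTan (x : Plane) : Continuous fun θ => inner ℝ x (unitTan θ) := by
  simp only [inner_unitTan]; fun_prop

lemma unitVec_periodic : Function.Periodic unitVec (2 * π) := by
  intro θ; simp [unitVec]

lemma unitTan_periodic : Function.Periodic unitTan (2 * π) := by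
  intro θ; simp [unitTan]

/-! ### Support functions -/

section SupportFun

variable {K : Set Plane}

lemma bddAbove_inner_image (hK : IsCompact K) (θ : ℝ) :
    BddAbove ((fun x => inner ℝ x (unitVec θ)) '' K) :=
  (hK.image (by fun_prop)).bddAbove

lemma inner_le_supportFun (hK : IsCompact K) {x : Plane} (hx : x ∈ K) (θ : ℝ) :
    inner ℝ x (unitVec θ) ≤ supportFun K θ :=
  le_csSup (bddAbove_inner_image hK θ) ⟨x, hx, rfl⟩

lemma exists_inner_eq_supportFun (hK : IsCompact K) (hne : K.Nonempty) (θ : ℝ) :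
    ∃ x ∈ K, inner ℝ x (unitVec θ) = supportFun K θ := by
  obtain ⟨x, hx, h⟩ := (hK.image (f := fun x => inner ℝ x (unitVec θ)) (by fun_prop)).sSup_mem
    (hne.image _)
  exact ⟨x, hx, h⟩

lemma supportFun_le_iff (hK : IsCompact K) (hne : K.Nonempty) {θ c : ℝ} :
    supportFun K θ ≤ c ↔ ∀ x ∈ K, inner ℝ x (unitVec θ) ≤ c := by
  refine ⟨fun h x hx => (inner_le_supportFun hK hx θ).trans h, fun h => ?_⟩
  obtain ⟨x, hx, hx'⟩ := exists_inner_eq_supportFun hK hne θ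
  exact hx' ▸ h x hx

lemma supportFun_periodic (K : Set Plane) : Function.Periodic (supportFun K) (2 * π) := by
  intro θ; simp only [supportFun, unitVec_periodic θ]

lemma supportFun_closedBall (x : Plane) {r : ℝ} (hr : 0 ≤ r) (θ : ℝ) :
    supportFun (Metric.closedBall x r) θ = inner ℝ x (unitVec θ) + r := by
  have hcpt := isCompact_closedBall x r
  have hne : (Metric.closedBall x r).Nonempty := ⟨x, by simp [hr]⟩
  apply le_antisymm
  · rw [supportFun_le_iff hcpt hne]
    intro y hy
    have h1 : inner ℝ (y - x) (unitVec θ) ≤ ‖y - x‖ * ‖unitVec θ‖ := real_inner_le_norm _ _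
    rw [norm_unitVec, inner_sub_left, mul_one] at h1
    rw [mem_closedBall_iff_norm] at hy
    linarith
  · have := inner_le_supportFun hcpt (x := x + r • unitVec θ)
      (by simp [norm_smul, norm_unitVec, abs_of_nonneg hr]) θ
    rwa [inner_add_left, inner_smul_left, real_inner_self_eq_norm_sq, norm_unitVec, one_pow,
      mul_one] at this

/-- A point outside `K` is separated from it by a functional, which by Riesz representation is a
nonnegative multiple of the pairing with some `unitVec θ`. -/
lemma mem_iff_forall_inner_le (hK : IsCompact K) (hconv : Convex ℝ K) (hne : K.Nonempty) {x : Plane} :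
    x ∈ K ↔ ∀ θ, inner ℝ x (unitVec θ) ≤ supportFun K θ := by
  refine ⟨fun h => inner_le_supportFun hK h, fun h => ?_⟩
  by_contra hx
  obtain ⟨f, u, hf, hu⟩ := geometric_hahn_banach_closed_point hconv hK.isClosed hx
  set w := (InnerProductSpace.toDual ℝ Plane).symm f
  have hfw : ∀ y, f y = inner ℝ w y := fun y => by simp [w]
  obtain ⟨θ, hθ⟩ := exists_eq_smul_unitVec w
  have hfy : ∀ y, f y = ‖w‖ * inner ℝ y (unitVec θ) := fun y => by
    rw [hfw, real_inner_comm]; nth_rw 1 [hθ]; rw [inner_smul_right]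
  obtain ⟨y, hy, hy'⟩ := exists_inner_eq_supportFun hK hne θ
  have h1 := hf y hy
  rw [hfy] at h1 hu
  have := mul_le_mul_of_nonneg_left (h θ) (norm_nonneg w)
  rw [hy'] at h1
  linarith

/-- Together with `closedBall_subset_iff`, this turns circumradius and inradius into extremal
problems for the support function. -/
lemma subset_closedBall_iff (hK : IsCompact K) (hne : K.Nonempty) {x : Plane} {r : ℝ} :
    K ⊆ Metric.closedBall x r ↔ ∀ θ, supportFun K θ ≤ inner ℝ x (unitVec θ) + r := by
  constructor
  · intro h θ
    have hr : 0 ≤ r := by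
      obtain ⟨y, hy⟩ := hne
      exact (norm_nonneg _).trans (mem_closedBall_iff_norm.1 (h hy))
    rw [supportFun_le_iff hK hne, ← supportFun_closedBall x hr]
    exact fun y hy => inner_le_supportFun (isCompact_closedBall x r) (h hy) θ
  · intro h y hy
    obtain ⟨θ, hθ⟩ := exists_eq_smul_unitVec (y - x)
    have h1 : inner ℝ (y - x) (unitVec θ) = ‖y - x‖ := by
      nth_rw 1 [hθ]
      rw [inner_smul_left, real_inner_self_eq_norm_sq, norm_unitVec]; simp
    have h2 := inner_le_supportFun hK hy θ
    rw [inner_sub_left] at h1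
    rw [mem_closedBall_iff_norm]
    linarith [h θ]

lemma closedBall_subset_iff (hK : IsCompact K) (hconv : Convex ℝ K) (hne : K.Nonempty) {x : Plane}
    {r : ℝ} (hr : 0 ≤ r) :
    Metric.closedBall x r ⊆ K ↔ ∀ θ, inner ℝ x (unitVec θ) + r ≤ supportFun K θ := by
  constructor
  · intro h θ
    rw [← supportFun_closedBall x hr, supportFun_le_iff (isCompact_closedBall x r) ⟨x, by simp [hr]⟩]
    exact fun y hy => inner_le_supportFun hK (h hy) θ
  · intro h y hy
    rw [mem_iff_forall_inner_le hK hconv hne]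
    intro θ
    have := inner_le_supportFun (isCompact_closedBall x r) hy θ
    rw [supportFun_closedBall x hr] at this
    exact this.trans (h θ)

end SupportFun

/-! ### Smoothness of the support function -/

/-- A negative second derivative would make `x` a local maximum as well, hence `f` locally constant
and the second derivative zero. -/
lemma deriv_deriv_nonneg_of_isLocalMin {f : ℝ → ℝ} {x : ℝ} (h : IsLocalMin f x)
    (hc : ContinuousAt f x) : 0 ≤ deriv (deriv f) x := by
  by_contra! hneg
  have hmax := isLocalMax_of_deriv_deriv_neg hneg h.deriv_eq_zero hc
  have heq : f =ᶠ[nhds x] fun _ => f x := by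
    filter_upwards [h, hmax] with y h1 h2 using le_antisymm h2 h1
  have h2 : deriv f =ᶠ[nhds x] deriv fun _ => f x := heq.deriv
  rw [h2.deriv_eq] at hneg
  simp at hneg

lemma unitVec_eq_of_unitTan_eq {φ θ : ℝ} (h : unitTan φ = unitTan θ) : unitVec φ = unitVec θ := by
  have h0 := congrArg (fun v : Plane => v 0) h
  have h1 := congrArg (fun v : Plane => v 1) h
  simp only [unitTan_zero, unitTan_one, neg_inj] at h0 h1
  exact plane_ext (by simpa using h1) (by simpa using h0)

lemma hasDerivAt_inner_left {c : ℝ → Plane} {c' : Plane} {t : ℝ} (hc : HasDerivAt c c' t)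
    (u : Plane) : HasDerivAt (fun s => inner ℝ (c s) u) (inner ℝ c' u) t := by
  simpa using hc.inner ℝ (hasDerivAt_const t u)

/-- Where a positively curved curve is farthest in the direction `unitVec φ`, its tangent has the
direction `unitTan φ`. -/
lemma deriv_eq_norm_smul_unitTan {c : ℝ → Plane} (hc : ContDiff ℝ ∞ c) {t φ : ℝ}
    (hpos : 0 < curvature c t) (hmax : IsLocalMax (fun s => inner ℝ (c s) (unitVec φ)) t) :
    deriv c t = ‖deriv c t‖ • unitTan φ := by
  have hd : ∀ s, HasDerivAt c (deriv c s) s := fun s =>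
    (hc.differentiable (by simp) s).hasDerivAt
  have hc' : ContDiff ℝ ∞ (deriv c) := (contDiff_infty_iff_deriv.1 hc).2
  have hd' : ∀ s, HasDerivAt (deriv c) (deriv (deriv c) s) s := fun s =>
    (hc'.differentiable (by simp) s).hasDerivAt
  have h1 : inner ℝ (deriv c t) (unitVec φ) = 0 :=
    hmax.hasDerivAt_eq_zero (hasDerivAt_inner_left (hd t) _)
  have h2 : inner ℝ (deriv (deriv c) t) (unitVec φ) ≤ 0 := by
    have hmin : IsLocalMin (fun s => -inner ℝ (c s) (unitVec φ)) t := hmax.neg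
    have e1 : deriv (fun s => -inner ℝ (c s) (unitVec φ))
        = fun s => -inner ℝ (deriv c s) (unitVec φ) :=
      funext fun s => (hasDerivAt_inner_left (hd s) _).neg.deriv
    have := deriv_deriv_nonneg_of_isLocalMin hmin
      (hasDerivAt_inner_left (hd t) _).neg.continuousAt
    rw [e1, (hasDerivAt_inner_left (hd' t) _).fun_neg.deriv] at this
    linarith
  have h3 := eq_inner_smul_add (deriv c t) φ
  rw [h1, zero_smul, zero_add] at h3
  set a := inner ℝ (deriv c t) (unitTan φ)
  have hcross : 0 < cross (deriv c t) (deriv (deriv c) t) := by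
    by_contra! hle
    exact absurd hpos (not_lt.2 (div_nonpos_of_nonpos_of_nonneg hle (by positivity)))
  -- Since `⟨c'', unitVec φ⟩ ≤ 0`, positivity of this product forces `a > 0`: the curve passes its
  -- farthest point counterclockwise.
  have hcr : cross (deriv c t) (deriv (deriv c) t)
      = -(a * inner ℝ (deriv (deriv c) t) (unitVec φ)) := by
    rw [h3, cross, inner_unitVec]
    simp only [PiLp.smul_apply, smul_eq_mul, unitTan_zero, unitTan_one]
    ring
  have ha : 0 < a := by
    by_contra! hle
    nlinarith
  nth_rw 2 [h3]
  rw [norm_smul, norm_unitTan, mul_one, norm_eq_abs, abs_of_pos ha]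
  exact h3

/-- The arctangent measures the angle from `unitTan θ` to `v`. Applied to the velocity of a curve,
it gives a local tangent angle that depends smoothly on the parameter. -/
lemma eq_norm_smul_unitTan_arctan {v : Plane} {θ : ℝ} (hv : 0 < inner ℝ v (unitTan θ)) :
    v = ‖v‖ • unitTan (θ + arctan (-inner ℝ v (unitVec θ) / inner ℝ v (unitTan θ))) := by
  set a := inner ℝ v (unitVec θ)
  set b := inner ℝ v (unitTan θ)
  have hv' : v = a • unitVec θ + b • unitTan θ := eq_inner_smul_add v θ
  have hsq := sin_sq_add_cos_sq θ
  have h1 : 0 < 1 + (-a / b) ^ 2 := by positivity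
  have hn : ‖v‖ = b * √(1 + (-a / b) ^ 2) := by
    rw [norm_eq, Real.sqrt_eq_iff_mul_self_eq (by positivity) (by positivity)]
    rw [show ∀ s : ℝ, b * s * (b * s) = b ^ 2 * (s * s) from fun s => by ring,
      Real.mul_self_sqrt h1.le, hv']
    simp only [PiLp.smul_apply, PiLp.add_apply, smul_eq_mul, unitVec_zero,
      unitVec_one, unitTan_zero, unitTan_one]
    field_simp
    linear_combination (a ^ 2 + b ^ 2) * hsq
  have hs : √(1 + (-a / b) ^ 2) ≠ 0 := (Real.sqrt_pos.2 h1).ne'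
  conv_lhs => rw [hv']
  rw [hn]
  apply plane_ext
  · simp only [PiLp.smul_apply, PiLp.add_apply, smul_eq_mul, unitVec_zero, unitTan_zero, sin_add,
      cos_arctan, sin_arctan]
    field_simp
    ring
  · simp only [PiLp.smul_apply, PiLp.add_apply, smul_eq_mul, unitVec_one, unitTan_one, cos_add,
      cos_arctan, sin_arctan]
    field_simp
    ring

section

variable {K : Set Plane}

lemma mem_frontier_of_inner_eq_supportFun (hK : IsCompact K) {x : Plane} (hx : x ∈ K) {θ : ℝ}
    (h : inner ℝ x (unitVec θ) = supportFun K θ) : x ∈ frontier K := by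
  rw [frontier, hK.isClosed.closure_eq]
  refine ⟨hx, fun hi => ?_⟩
  obtain ⟨ε, hε, hb⟩ := Metric.mem_nhds_iff.1 (mem_interior_iff_mem_nhds.1 hi)
  have hy : x + (ε / 2) • unitVec θ ∈ K := hb (by
    simp [norm_smul, norm_unitVec, abs_of_pos hε, hε])
  have := inner_le_supportFun hK hy θ
  rw [inner_add_left, inner_smul_left, real_inner_self_eq_norm_sq, norm_unitVec] at this
  simp at this
  linarith

lemma exists_supporting_direction (hK : IsCompact K) (hconv : Convex ℝ K)
    (hint : (interior K).Nonempty) {x : Plane} (hx : x ∈ frontier K) :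
    ∃ θ, inner ℝ x (unitVec θ) = supportFun K θ := by
  have hxK : x ∈ K := hK.isClosed.frontier_subset hx
  obtain ⟨f, hf0, hf⟩ := geometric_hahn_banach_of_nonempty_interior_point hconv hx.2 hint
  set w := (InnerProductSpace.toDual ℝ Plane).symm f
  have hfw : ∀ y, f y = inner ℝ w y := fun y => by simp [w]
  obtain ⟨θ, hθ⟩ := exists_eq_smul_unitVec w
  have hw : 0 < ‖w‖ := by
    rw [norm_pos_iff]
    intro h0
    exact hf0 (by ext y; simp [hfw, h0])
  have hfy : ∀ y, f y = ‖w‖ * inner ℝ y (unitVec θ) := fun y => by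
    rw [hfw, real_inner_comm]; nth_rw 1 [hθ]; rw [inner_smul_right]
  refine ⟨θ, le_antisymm (inner_le_supportFun hK hxK θ) ?_⟩
  rw [supportFun_le_iff hK ⟨x, hxK⟩]
  intro y hy
  have := hf y hy
  rw [hfy, hfy] at this
  exact le_of_mul_le_mul_left this hw

namespace IsSmoothStrictlyConvexDomain

lemma convex (hK : IsSmoothStrictlyConvexDomain K) : Convex ℝ K := hK.strictConvex.convex

lemma nonempty (hK : IsSmoothStrictlyConvexDomain K) : K.Nonempty :=
  hK.interior_nonempty.mono interior_subset

/-- A regular boundary has no corners: in every supporting direction at `x`, the velocity of the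
boundary curve is the matching tangent, so it determines the direction. -/
lemma unitVec_eq (hK : IsSmoothStrictlyConvexDomain K) {x : Plane} (hx : x ∈ K) {φ θ : ℝ}
    (hφ : inner ℝ x (unitVec φ) = supportFun K φ) (hθ : inner ℝ x (unitVec θ) = supportFun K θ) :
    unitVec φ = unitVec θ := by
  obtain ⟨T, c, -, hc, -, -, hr, hreg, hcurv⟩ := hK.exists_boundary_curve
  have hcK : ∀ s, c s ∈ K := fun s =>
    hK.isCompact.isClosed.frontier_subset (hr ▸ Set.mem_range_self s)
  obtain ⟨t, rfl⟩ : x ∈ Set.range c := hr ▸ mem_frontier_of_inner_eq_supportFun hK.isCompact hx hφ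
  have key : ∀ ψ, inner ℝ (c t) (unitVec ψ) = supportFun K ψ →
      deriv c t = ‖deriv c t‖ • unitTan ψ := fun ψ hψ =>
    deriv_eq_norm_smul_unitTan hc (hcurv t)
      (Filter.Eventually.of_forall fun s => by
        simpa only [hψ] using inner_le_supportFun hK.isCompact (hcK s) ψ)
  have h := (key φ hφ).symm.trans (key θ hθ)
  exact unitVec_eq_of_unitTan_eq (smul_right_injective _ (norm_ne_zero_iff.2 (hreg t)) h)

/-- Near a contact point the tangent angle `ψ` of the given boundary curve has nonzero derivative,
by positive curvature. Its smooth local inverse `τ` finds the contact point in direction `φ`, so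
`p(φ) = ⟨c(τ φ), unitVec φ⟩` locally. -/
lemma contDiff_supportFun (hK : IsSmoothStrictlyConvexDomain K) :
    ContDiff ℝ ∞ (supportFun K) := by
  obtain ⟨T, c, -, hc, -, -, hr, hreg, hcurv⟩ := hK.exists_boundary_curve
  have hcf : ∀ s, c s ∈ frontier K := fun s => hr ▸ Set.mem_range_self s
  have hcK : ∀ s, c s ∈ K := fun s => hK.isCompact.isClosed.frontier_subset (hcf s)
  have hN : ∀ t ψ, inner ℝ (c t) (unitVec ψ) = supportFun K ψ →
      deriv c t = ‖deriv c t‖ • unitTan ψ := fun t ψ hψ =>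
    deriv_eq_norm_smul_unitTan hc (hcurv t)
      (Filter.Eventually.of_forall fun s => by
        simpa only [hψ] using inner_le_supportFun hK.isCompact (hcK s) ψ)
  have hc' : ContDiff ℝ ∞ (deriv c) := (contDiff_infty_iff_deriv.1 hc).2
  rw [contDiff_iff_contDiffAt]
  intro θ
  obtain ⟨x, hxK, hx⟩ := exists_inner_eq_supportFun hK.isCompact hK.nonempty θ
  obtain ⟨t, rfl⟩ : x ∈ Set.range c := hr ▸ mem_frontier_of_inner_eq_supportFun hK.isCompact hxK hx
  have hv := hN t θ hx
  have hvpos : 0 < ‖deriv c t‖ := norm_pos_iff.2 (hreg t)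
  have hb : inner ℝ (deriv c t) (unitTan θ) = ‖deriv c t‖ := by
    nth_rw 1 [hv]
    rw [inner_smul_left, real_inner_self_eq_norm_sq, norm_unitTan]; simp
  have ha : inner ℝ (deriv c t) (unitVec θ) = 0 := by
    rw [hv, inner_smul_left, inner_unitVec]; simp; right; ring
  set a : ℝ → ℝ := fun s => inner ℝ (deriv c s) (unitVec θ)
  set b : ℝ → ℝ := fun s => inner ℝ (deriv c s) (unitTan θ)
  have hac : ContDiff ℝ ∞ a := hc'.inner ℝ contDiff_const
  have hbc : ContDiff ℝ ∞ b := hc'.inner ℝ contDiff_const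
  set ψ : ℝ → ℝ := fun s => θ + arctan (-a s / b s)
  have hb0 : b t ≠ 0 := by simp only [b, hb]; exact hvpos.ne'
  have hψc : ContDiffAt ℝ ∞ ψ t :=
    contDiffAt_const.add ((hac.contDiffAt.neg.div hbc.contDiffAt hb0).arctan)
  have hψt : ψ t = θ := by simp [ψ, a, ha]
  set d := deriv ψ t
  have hψd : HasDerivAt ψ d t := (hψc.differentiableAt (by simp)).hasDerivAt
  have hd : d ≠ 0 := by
    have h1 : HasDerivAt a (inner ℝ (deriv (deriv c) t) (unitVec θ)) t :=
      hasDerivAt_inner_left (hc'.differentiable (by simp) t).hasDerivAt _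
    have h2 : HasDerivAt b (inner ℝ (deriv (deriv c) t) (unitTan θ)) t :=
      hasDerivAt_inner_left (hc'.differentiable (by simp) t).hasDerivAt _
    have h3 := ((h1.neg.div h2 hb0).arctan).const_add θ
    have h4 : d = _ := hψd.unique h3
    rw [h4]
    have hat : a t = 0 := ha
    simp only [Pi.neg_apply, hat]
    have hcurv' := hcurv t
    intro h0
    have : inner ℝ (deriv (deriv c) t) (unitVec θ) = 0 := by
      simp [hb0] at h0
      refine h0.resolve_left (by positivity)
    have hcr : cross (deriv c t) (deriv (deriv c) t) = 0 := by
      rw [hv, cross]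
      rw [inner_unitVec] at this
      simp only [PiLp.smul_apply, smul_eq_mul, unitTan_zero, unitTan_one]
      linear_combination (-‖deriv c t‖) * this
    rw [curvature, hcr] at hcurv'
    simp at hcurv'
  let e : ℝ ≃L[ℝ] ℝ := ContinuousLinearEquiv.unitsEquivAut ℝ (Units.mk0 d hd)
  have hψf : HasFDerivAt ψ (e : ℝ →L[ℝ] ℝ) t := by
    have : (e : ℝ →L[ℝ] ℝ) = ContinuousLinearMap.toSpanSingleton ℝ d := by
      ext; simp [e]
    rw [this]
    exact hψd.hasFDerivAt
  have hτ := hψc.to_localInverse hψf (by simp)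
  have hτt := hψc.localInverse_apply_image hψf (by simp)
  set τ := hψc.localInverse hψf (by simp)
  rw [hψt] at hτ hτt
  have hright : ∀ᶠ φ in nhds θ, ψ (τ φ) = φ := by
    have := (hψc.hasStrictFDerivAt' hψf (by simp)).eventually_right_inverse
    rwa [hψt] at this
  have hbpos : ∀ᶠ φ in nhds θ, 0 < b (τ φ) := by
    have hcont : ContinuousAt (fun φ => b (τ φ)) θ :=
      hbc.continuous.continuousAt.comp hτ.continuousAt
    exact hcont.eventually_const_lt (by simp only [hτt, b, hb]; exact hvpos)
  have hev : supportFun K =ᶠ[nhds θ] fun φ => inner ℝ (c (τ φ)) (unitVec φ) := by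
    filter_upwards [hright, hbpos] with φ h1 h2
    have h3 : deriv c (τ φ) = ‖deriv c (τ φ)‖ • unitTan φ := by
      have h := eq_norm_smul_unitTan_arctan h2
      change _ = _ • unitTan (ψ (τ φ)) at h
      rwa [h1] at h
    -- Having tangent direction `φ` does not yet make `c (τ φ)` extremal in direction `φ`. Convexity
    -- supplies some supporting direction, and comparing tangents identifies it with `φ`.
    obtain ⟨φ', hφ'⟩ := exists_supporting_direction hK.isCompact hK.convex hK.interior_nonempty
      (hcf (τ φ))
    have h4 := (hN _ _ hφ').symm.trans h3
    have h5 := unitVec_eq_of_unitTan_eq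
      (smul_right_injective _ (norm_ne_zero_iff.2 (hreg (τ φ))) h4)
    have h6 : supportFun K φ' = supportFun K φ := by simp only [supportFun, h5]
    rw [← h6, ← hφ', h5]
  refine ContDiffAt.congr_of_eventuallyEq ?_ hev
  have hu : ContDiff ℝ ∞ unitVec := by
    rw [contDiff_euclidean]
    intro i
    fin_cases i
    · exact contDiff_cos
    · exact contDiff_sin
  exact (hc.contDiffAt.comp θ hτ).inner ℝ hu.contDiffAt

end IsSmoothStrictlyConvexDomain

end

/-! ### The boundary curve in terms of the support function -/

lemma hasDerivAt_plane {c : ℝ → Plane} {v : Plane} {t : ℝ}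
    (h0 : HasDerivAt (fun s => c s 0) (v 0) t) (h1 : HasDerivAt (fun s => c s 1) (v 1) t) :
    HasDerivAt c v t := by
  have h := hasFDerivWithinAt_euclidean (t := Set.univ) (y := t) (f := c)
    (f' := ContinuousLinearMap.toSpanSingleton ℝ v)
  rw [hasFDerivWithinAt_univ] at h
  rw [hasDerivAt_iff_hasFDerivAt, h]
  intro i
  rw [hasFDerivWithinAt_univ]
  have e : PiLp.proj 2 (fun _ : Fin 2 => ℝ) i ∘L ContinuousLinearMap.toSpanSingleton ℝ v
      = ContinuousLinearMap.toSpanSingleton ℝ (v i) := by ext; simp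
  rw [e]
  fin_cases i
  · exact h0.hasFDerivAt
  · exact h1.hasFDerivAt

lemma hasDerivAt_coord {c : ℝ → Plane} {v : Plane} {t : ℝ} (h : HasDerivAt c v t) (i : Fin 2) :
    HasDerivAt (fun s => c s i) (v i) t :=
  (PiLp.proj (𝕜 := ℝ) 2 (fun _ : Fin 2 => ℝ) i).hasFDerivAt.comp_hasDerivAt t h

lemma hasDerivAt_unitVec (θ : ℝ) : HasDerivAt unitVec (unitTan θ) θ :=
  hasDerivAt_plane (hasDerivAt_cos θ) (hasDerivAt_sin θ)

lemma hasDerivAt_unitTan (θ : ℝ) : HasDerivAt unitTan (-unitVec θ) θ :=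
  hasDerivAt_plane (hasDerivAt_sin θ).neg (hasDerivAt_cos θ)

lemma cross_smul_smul (a b : ℝ) (v w : Plane) : cross (a • v) (b • w) = a * b * cross v w := by
  simp only [cross, PiLp.smul_apply, smul_eq_mul]; ring

lemma cross_add_right (v w z : Plane) : cross v (w + z) = cross v w + cross v z := by
  simp only [cross, PiLp.add_apply]; ring

lemma cross_unitVec_unitTan (θ : ℝ) : cross (unitVec θ) (unitTan θ) = 1 := by
  simp [cross, ← sq]

lemma cross_unitTan_unitVec (θ : ℝ) : cross (unitTan θ) (unitVec θ) = -1 := by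
  simp only [cross, unitTan_zero, unitTan_one, unitVec_zero, unitVec_one]
  linarith [sin_sq_add_cos_sq θ]

lemma cross_self (v : Plane) : cross v v = 0 := by simp [cross, mul_comm]

/-! ### Curvature, evolute and length in terms of the support function -/

/-- The curvature radius `p + p''` in terms of the support function. -/
def curvRadius (K : Set Plane) (θ : ℝ) : ℝ := supportFun K θ + deriv (deriv (supportFun K)) θ

namespace IsSmoothStrictlyConvexDomain

variable {K : Set Plane}

lemma contDiff_deriv (hK : IsSmoothStrictlyConvexDomain K) : ContDiff ℝ ∞ (deriv (supportFun K)) :=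
  (contDiff_infty_iff_deriv.1 hK.contDiff_supportFun).2

lemma contDiff_deriv_deriv (hK : IsSmoothStrictlyConvexDomain K) : ContDiff ℝ ∞ (deriv (deriv (supportFun K))) :=
  (contDiff_infty_iff_deriv.1 hK.contDiff_deriv).2

lemma contDiff_curvRadius (hK : IsSmoothStrictlyConvexDomain K) : ContDiff ℝ ∞ (curvRadius K) :=
  hK.contDiff_supportFun.add hK.contDiff_deriv_deriv

lemma hasDerivAt_supportFun (hK : IsSmoothStrictlyConvexDomain K) (θ : ℝ) :
    HasDerivAt (supportFun K) (deriv (supportFun K) θ) θ :=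
  (hK.contDiff_supportFun.differentiable (by simp) θ).hasDerivAt

lemma hasDerivAt_deriv_supportFun (hK : IsSmoothStrictlyConvexDomain K) (θ : ℝ) :
    HasDerivAt (deriv (supportFun K)) (curvRadius K θ - supportFun K θ) θ :=
  (hK.contDiff_deriv.differentiable (by simp) θ).hasDerivAt.congr_deriv (by simp [curvRadius])

lemma hasDerivAt_curvRadius (hK : IsSmoothStrictlyConvexDomain K) (θ : ℝ) :
    HasDerivAt (curvRadius K) (deriv (curvRadius K) θ) θ :=
  (hK.contDiff_curvRadius.differentiable (by simp) θ).hasDerivAt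

lemma continuous_supportFun (hK : IsSmoothStrictlyConvexDomain K) : Continuous (supportFun K) := hK.contDiff_supportFun.continuous

lemma continuous_deriv_supportFun (hK : IsSmoothStrictlyConvexDomain K) : Continuous (deriv (supportFun K)) :=
  hK.contDiff_deriv.continuous

lemma continuous_curvRadius (hK : IsSmoothStrictlyConvexDomain K) : Continuous (curvRadius K) := hK.contDiff_curvRadius.continuous

lemma continuous_deriv_curvRadius (hK : IsSmoothStrictlyConvexDomain K) : Continuous (deriv (curvRadius K)) :=
  (contDiff_infty_iff_deriv.1 hK.contDiff_curvRadius).2.continuous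

/-- A point of `K` that is extremal in the direction `θ` is the boundary point `γ(θ)`. -/
lemma eq_boundaryCurve (hK : IsSmoothStrictlyConvexDomain K) {x : Plane} (hx : x ∈ K) {θ : ℝ}
    (h : inner ℝ x (unitVec θ) = supportFun K θ) : x = boundaryCurve K θ := by
  have hmin : IsLocalMin (fun φ => supportFun K φ - inner ℝ x (unitVec φ)) θ :=
    Filter.Eventually.of_forall fun φ => by
      simpa [h] using inner_le_supportFun hK.isCompact hx φ
  have := hmin.hasDerivAt_eq_zero
    ((hK.hasDerivAt_supportFun θ).fun_sub (hasDerivAt_inner_unitVec x θ))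
  rw [boundaryCurve, ← h, sub_eq_zero.1 this]
  exact eq_inner_smul_add x θ

lemma boundaryCurve_mem (hK : IsSmoothStrictlyConvexDomain K) (θ : ℝ) : boundaryCurve K θ ∈ K := by
  obtain ⟨x, hx, h⟩ := exists_inner_eq_supportFun hK.isCompact hK.nonempty θ
  exact hK.eq_boundaryCurve hx h ▸ hx

lemma inner_boundaryCurve (K : Set Plane) (θ : ℝ) :
    inner ℝ (boundaryCurve K θ) (unitVec θ) = supportFun K θ := by
  rw [inner_unitVec, boundaryCurve]
  simp only [PiLp.add_apply, PiLp.smul_apply, smul_eq_mul, unitVec_zero, unitVec_one,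
    unitTan_zero, unitTan_one]
  linear_combination supportFun K θ * sin_sq_add_cos_sq θ

/-- The function `p - ⟨γ(θ), unitVec ·⟩` is nonnegative and vanishes at `θ`; its second derivative
there is `p + p''`. -/
lemma curvRadius_nonneg (hK : IsSmoothStrictlyConvexDomain K) (θ : ℝ) : 0 ≤ curvRadius K θ := by
  set x := boundaryCurve K θ
  have hmin : IsLocalMin (fun φ => supportFun K φ - inner ℝ x (unitVec φ)) θ :=
    Filter.Eventually.of_forall fun φ => by
      simpa [x, inner_boundaryCurve K θ] using
        inner_le_supportFun hK.isCompact (hK.boundaryCurve_mem θ) φ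
  have hd : ∀ φ, HasDerivAt (fun φ => supportFun K φ - inner ℝ x (unitVec φ))
      (deriv (supportFun K) φ - inner ℝ x (unitTan φ)) φ := fun φ =>
    (hK.hasDerivAt_supportFun φ).fun_sub (hasDerivAt_inner_unitVec x φ)
  have := deriv_deriv_nonneg_of_isLocalMin hmin (hd θ).continuousAt
  rw [funext fun φ => (hd φ).deriv, ((hK.hasDerivAt_deriv_supportFun θ).fun_sub
    (hasDerivAt_inner_unitTan x θ)).deriv, inner_boundaryCurve K θ] at this
  linarith

lemma hasDerivAt_boundaryCurve (hK : IsSmoothStrictlyConvexDomain K) (θ : ℝ) :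
    HasDerivAt (boundaryCurve K) (curvRadius K θ • unitTan θ) θ := by
  refine (((hK.hasDerivAt_supportFun θ).smul (hasDerivAt_unitVec θ)).add
    ((hK.hasDerivAt_deriv_supportFun θ).smul (hasDerivAt_unitTan θ))).congr_deriv ?_
  module

lemma kappa_eq (hK : IsSmoothStrictlyConvexDomain K) (θ : ℝ) : kappa K θ = 1 / curvRadius K θ := by
  have h1 : deriv (boundaryCurve K) = fun θ => curvRadius K θ • unitTan θ :=
    funext fun θ => (hK.hasDerivAt_boundaryCurve θ).deriv
  have h2 : deriv (deriv (boundaryCurve K)) θ = curvRadius K θ • -unitVec θ +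
      deriv (curvRadius K) θ • unitTan θ := by
    rw [h1]; exact ((hK.hasDerivAt_curvRadius θ).smul (hasDerivAt_unitTan θ)).deriv
  rw [kappa, curvature, h2, h1, cross_add_right, smul_neg, ← neg_smul, cross_smul_smul,
    cross_smul_smul, cross_self, cross_unitTan_unitVec, norm_smul, norm_unitTan, norm_eq_abs,
    abs_of_nonneg (hK.curvRadius_nonneg θ)]
  -- Nonnegativity is enough: if the curvature radius were zero, both sides would be zero by the
  -- convention for division.
  rcases eq_or_ne (curvRadius K θ) 0 with h | h
  · simp [h]
  · field_simp; ring

lemma rho_eq (hK : IsSmoothStrictlyConvexDomain K) (θ : ℝ) : rho K θ = curvRadius K θ := by rw [rho, hK.kappa_eq, one_div_one_div]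

lemma centersLocus_eq (hK : IsSmoothStrictlyConvexDomain K) (θ : ℝ) : centersLocus K θ =
    boundaryCurve K θ - curvRadius K θ • unitVec θ := by
  rw [centersLocus, hK.rho_eq, smul_neg, sub_eq_add_neg]

lemma hasDerivAt_centersLocus (hK : IsSmoothStrictlyConvexDomain K) (θ : ℝ) :
    HasDerivAt (centersLocus K) (-deriv (curvRadius K) θ • unitVec θ) θ := by
  rw [funext hK.centersLocus_eq]
  refine ((hK.hasDerivAt_boundaryCurve θ).sub
    ((hK.hasDerivAt_curvRadius θ).smul (hasDerivAt_unitVec θ))).congr_deriv ?_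
  module

lemma rhoBeta_eq (hK : IsSmoothStrictlyConvexDomain K) (θ : ℝ) : rhoBeta K θ = |deriv (curvRadius K) θ| := by
  have h1 : deriv (centersLocus K) = fun θ => -deriv (curvRadius K) θ • unitVec θ :=
    funext fun θ => (hK.hasDerivAt_centersLocus θ).deriv
  have h3 : HasDerivAt (deriv (curvRadius K)) (deriv (deriv (curvRadius K)) θ) θ :=
    ((contDiff_infty_iff_deriv.1 hK.contDiff_curvRadius).2.differentiable (by simp) θ).hasDerivAt
  have h2 : deriv (deriv (centersLocus K)) θ = -deriv (curvRadius K) θ • unitTan θ +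
      -deriv (deriv (curvRadius K)) θ • unitVec θ := by
    rw [h1]; exact (h3.fun_neg.smul (hasDerivAt_unitVec θ)).deriv
  rw [rhoBeta, curvature, h2, h1, cross_add_right, cross_smul_smul, cross_smul_smul, cross_self,
    cross_unitVec_unitTan, norm_smul, norm_unitVec, norm_eq_abs, abs_neg]
  -- At a cusp of the evolute both sides are zero, again by the convention for division.
  rcases eq_or_ne (deriv (curvRadius K) θ) 0 with h | h
  · simp [h]
  · have : (-deriv (curvRadius K) θ * -deriv (curvRadius K) θ * 1
        + -deriv (curvRadius K) θ * -deriv (deriv (curvRadius K)) θ * 0)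
        = |deriv (curvRadius K) θ| ^ 2 := by rw [sq_abs]; ring
    rw [this]
    have := abs_pos.2 h
    rw [mul_one, show |deriv (curvRadius K) θ| ^ 2 / |deriv (curvRadius K) θ| ^ 3
      = 1 / |deriv (curvRadius K) θ| by field_simp, one_div_one_div, abs_abs]

lemma perimeter_eq (hK : IsSmoothStrictlyConvexDomain K) : perimeter K = ∫ θ in (0 : ℝ)..2 * π, curvRadius K θ := by
  simp only [perimeter, curveLength, (hK.hasDerivAt_boundaryCurve _).deriv, norm_smul,
    norm_unitTan, mul_one, norm_eq_abs, abs_of_nonneg (hK.curvRadius_nonneg _)]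

lemma centersArea_eq (hK : IsSmoothStrictlyConvexDomain K) : centersArea K =
    1 / 2 * ∫ θ in (0 : ℝ)..2 * π, deriv (supportFun K) θ * deriv (curvRadius K) θ := by
  rw [centersArea, orientedArea]
  congr 2
  ext θ
  rw [(hK.hasDerivAt_centersLocus θ).deriv, hK.centersLocus_eq, boundaryCurve]
  simp only [cross, PiLp.sub_apply, PiLp.add_apply, PiLp.smul_apply, smul_eq_mul, unitVec_zero,
    unitVec_one, unitTan_zero, unitTan_one]
  linear_combination (deriv (supportFun K) θ * deriv (curvRadius K) θ) * sin_sq_add_cos_sq θ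

lemma curvatureEnergy_nonneg (K : Set Plane) : 0 ≤ curvatureEnergy K :=
  intervalIntegral.integral_nonneg two_pi_pos.le fun _ _ => by positivity

lemma deriv_periodic {f : ℝ → ℝ} {T : ℝ} (h : Function.Periodic f T) :
    Function.Periodic (deriv f) T := by
  intro x
  rw [← deriv_comp_add_const, funext h]

lemma curvRadius_periodic (K : Set Plane) : Function.Periodic (curvRadius K) (2 * π) := fun θ => by
  simp only [curvRadius, supportFun_periodic K θ,
    deriv_periodic (deriv_periodic (supportFun_periodic K)) θ]

/-! ### The area in terms of the support function -/

lemma inner_lt_supportFun (hK : IsSmoothStrictlyConvexDomain K) {x : Plane} (hx : x ∈ interior K) (θ : ℝ) :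
    inner ℝ x (unitVec θ) < supportFun K θ := by
  refine lt_of_le_of_ne (inner_le_supportFun hK.isCompact (interior_subset hx) θ) fun h => ?_
  exact (mem_frontier_of_inner_eq_supportFun hK.isCompact (interior_subset hx) h).2 hx

lemma unitVec_injOn : Set.InjOn unitVec (Set.Ioc 0 (2 * π)) := by
  intro θ hθ φ hφ h
  have h0 : cos θ = cos φ := congrArg (fun v : Plane => v 0) h
  have h1 : sin θ = sin φ := congrArg (fun v : Plane => v 1) h
  have h2 : cos (θ - φ) = 1 := by
    rw [cos_sub, h0, h1]; linarith [sin_sq_add_cos_sq φ]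
  have := (cos_eq_one_iff_of_lt_of_lt (by linarith [hθ.1, hφ.2]) (by linarith [hθ.2, hφ.1])).1 h2
  linarith

/-- `K` in polar coordinates about `x₀`, with the boundary curve as unit circle. -/
def polarMap (K : Set Plane) (x₀ : Plane) (z : ℝ × ℝ) : ℝ × ℝ :=
  (x₀ 0 + z.1 * (boundaryCurve K z.2 0 - x₀ 0), x₀ 1 + z.1 * (boundaryCurve K z.2 1 - x₀ 1))

lemma measurePreserving_toPlane :
    MeasurePreserving (fun w : ℝ × ℝ => (!₂[w.1, w.2] : Plane)) := by
  exact (PiLp.volume_preserving_toLp (Fin 2)).comp (volume_preserving_finTwoArrow ℝ).symm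

/-- Pairing with `unitVec θ`, in whose direction `γ(θ)` is extremal, gives `s ≤ r`, and symmetry
gives equality. The boundary points then agree, and a boundary point has only one outward normal. -/
lemma polarMap_injOn (hK : IsSmoothStrictlyConvexDomain K) {x₀ : Plane} (hx₀ : x₀ ∈ interior K) :
    Set.InjOn (polarMap K x₀) (Set.Ioc 0 1 ×ˢ Set.Ioc 0 (2 * π)) := by
  have hle : ∀ s θ r φ : ℝ, 0 < s → 0 < r → polarMap K x₀ (s, θ) = polarMap K x₀ (r, φ) →
      s ≤ r := by
    intro s θ r φ hs hr h
    have hh := hK.inner_lt_supportFun hx₀ θ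
    have h1 := inner_le_supportFun hK.isCompact (hK.boundaryCurve_mem φ) θ
    have h2 := inner_boundaryCurve K θ
    simp only [polarMap, Prod.mk.injEq, add_right_inj] at h
    rw [inner_unitVec] at h1 h2 hh
    obtain ⟨ha, hb⟩ := h
    have h3 : s * (supportFun K θ - (x₀ 0 * cos θ + x₀ 1 * sin θ))
        ≤ r * (supportFun K θ - (x₀ 0 * cos θ + x₀ 1 * sin θ)) := by
      have h4 : s * (supportFun K θ - (x₀ 0 * cos θ + x₀ 1 * sin θ)) =
          r * ((boundaryCurve K φ 0 * cos θ + boundaryCurve K φ 1 * sin θ)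
            - (x₀ 0 * cos θ + x₀ 1 * sin θ)) := by
        rw [← h2]
        linear_combination cos θ * ha + sin θ * hb
      rw [h4]
      exact mul_le_mul_of_nonneg_left (by linarith) hr.le
    exact le_of_mul_le_mul_right h3 (by linarith)
  rintro ⟨s, θ⟩ ⟨hs, hθ⟩ ⟨r, φ⟩ ⟨hr, hφ⟩ h
  have hsr : s = r := le_antisymm (hle _ _ _ _ hs.1 hr.1 h) (hle _ _ _ _ hr.1 hs.1 h.symm)
  subst hsr
  simp only [polarMap, Prod.mk.injEq, add_right_inj, mul_right_inj' (ne_of_gt hs.1),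
    sub_left_inj] at h
  have hγ : boundaryCurve K θ = boundaryCurve K φ := plane_ext h.1 h.2
  have hu := hK.unitVec_eq (hK.boundaryCurve_mem θ) (inner_boundaryCurve K θ)
    (hγ ▸ inner_boundaryCurve K φ)
  exact congrArg (Prod.mk s) (unitVec_injOn hθ hφ hu)

lemma image_polarMap (hK : IsSmoothStrictlyConvexDomain K) {x₀ : Plane} (hx₀ : x₀ ∈ interior K) :
    polarMap K x₀ '' (Set.Ioc 0 1 ×ˢ Set.Ioc 0 (2 * π)) =
      (fun w : ℝ × ℝ => (!₂[w.1, w.2] : Plane)) ⁻¹' (K \ {x₀}) := by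
  have hpm : ∀ z : ℝ × ℝ, (!₂[(polarMap K x₀ z).1, (polarMap K x₀ z).2] : Plane)
      = x₀ + z.1 • (boundaryCurve K z.2 - x₀) := fun z => by
    apply plane_ext <;> simp [polarMap]
  ext w
  constructor
  · rintro ⟨⟨s, θ⟩, ⟨hs, hθ⟩, rfl⟩
    simp only at hs hθ
    rw [Set.mem_preimage, hpm]
    refine ⟨?_, ?_⟩
    · exact hK.convex.add_smul_sub_mem (interior_subset hx₀) (hK.boundaryCurve_mem θ) ⟨hs.1.le, hs.2⟩
    · simp only [Set.mem_singleton_iff, add_eq_left, smul_eq_zero, hs.1.ne', false_or, sub_eq_zero]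
      intro h
      have := hK.inner_lt_supportFun hx₀ θ
      rw [← h, inner_boundaryCurve] at this
      exact lt_irrefl _ this
  · rintro ⟨hxK, hne⟩
    set x : Plane := !₂[w.1, w.2] with hx
    set y := x - x₀ with hy
    have hy0 : y ≠ 0 := sub_ne_zero.2 hne
    set h : ℝ → ℝ := fun θ => supportFun K θ - inner ℝ x₀ (unitVec θ)
    have hpos : ∀ θ, 0 < h θ := fun θ => sub_pos.2 (hK.inner_lt_supportFun hx₀ θ)
    have hhc : Continuous h := hK.continuous_supportFun.sub (continuous_inner_unitVec x₀)
    -- The maximum of `g` is the gauge of `y` with respect to `K - x₀`, hence the radial coordinate.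
    -- Stationarity at a maximizer `θ` matches the tangential components, so `y` is a multiple of
    -- `γ(θ) - x₀`.
    set g : ℝ → ℝ := fun θ => inner ℝ y (unitVec θ) / h θ
    have hgc : Continuous g := (continuous_inner_unitVec y).div hhc fun θ => (hpos θ).ne'
    have hgper : Function.Periodic g (2 * π) := fun θ => by
      simp only [g, h, unitVec_periodic θ, supportFun_periodic K θ]
    obtain ⟨z, hz, hzmax⟩ := (isCompact_Icc (a := (0 : ℝ)) (b := 2 * π)).exists_isMaxOn
      ⟨0, by simp [pi_pos.le]⟩ hgc.continuousOn
    obtain ⟨θ, hθ, hzθ⟩ := hgper.exists_mem_Ioc two_pi_pos z 0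
    rw [zero_add] at hθ
    have hmax : ∀ φ, g φ ≤ g θ := fun φ => by
      obtain ⟨φ', hφ', he⟩ := hgper.exists_mem_Ioc two_pi_pos φ 0
      rw [zero_add] at hφ'
      rw [he, ← hzθ]
      exact hzmax (Set.Ioc_subset_Icc_self hφ')
    have hg1 : g θ ≤ 1 := by
      rw [div_le_one (hpos θ), hy, inner_sub_left]
      exact sub_le_sub_right (inner_le_supportFun hK.isCompact hxK θ) _
    have hg0 : 0 < g θ := by
      obtain ⟨φ, hφ⟩ := exists_eq_smul_unitVec y
      refine lt_of_lt_of_le ?_ (hmax φ)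
      refine div_pos ?_ (hpos φ)
      rw [hφ, inner_smul_left, real_inner_self_eq_norm_sq, norm_unitVec]
      simpa using hy0
    refine ⟨(g θ, θ), ⟨⟨hg0, hg1⟩, hθ⟩, ?_⟩
    have e0 : g θ * h θ = inner ℝ y (unitVec θ) := div_mul_cancel₀ _ (hpos θ).ne'
    have hmin : IsLocalMin (fun φ => g θ * h φ - inner ℝ y (unitVec φ)) θ :=
      Filter.Eventually.of_forall fun φ => by
        have := (div_le_iff₀ (hpos φ)).1 (hmax φ)
        simp only [e0, sub_self]
        linarith
    have e1 := hmin.hasDerivAt_eq_zero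
      ((((hK.hasDerivAt_supportFun θ).fun_sub (hasDerivAt_inner_unitVec x₀ θ)).const_mul
        (g θ)).fun_sub (hasDerivAt_inner_unitVec y θ))
    have key : x = x₀ + g θ • (boundaryCurve K θ - x₀) := by
      have hx0 := eq_inner_smul_add x₀ θ
      have hyy := eq_inner_smul_add y θ
      rw [← e0, ← sub_eq_zero.1 e1] at hyy
      have : x = x₀ + y := by rw [hy]; abel
      rw [this, hyy]
      congr 1
      have hb : boundaryCurve K θ - x₀ = h θ • unitVec θ
          + (deriv (supportFun K) θ - inner ℝ x₀ (unitTan θ)) • unitTan θ := by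
        conv_lhs => rw [hx0]
        simp only [boundaryCurve, h]
        module
      rw [hb]
      module
    have h0 := congrArg (fun v : Plane => v 0) key
    have h1 := congrArg (fun v : Plane => v 1) key
    simp only [hx, PiLp.add_apply, PiLp.smul_apply, PiLp.sub_apply, smul_eq_mul] at h0 h1
    exact Prod.ext h0.symm h1.symm

/-- Change of variables with `polarMap`, whose Jacobian is `s (p - ⟨x₀, unitVec θ⟩) ρ`; integrating
`s` over `(0, 1]` gives the factor `1/2`. The omitted point `x₀` is a null set. -/
lemma area_eq_integral_of_mem_interior (hK : IsSmoothStrictlyConvexDomain K) {x₀ : Plane} (hx₀ : x₀ ∈ interior K) :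
    area K = 1 / 2 * ∫ θ in (0 : ℝ)..2 * π,
      (supportFun K θ - inner ℝ x₀ (unitVec θ)) * curvRadius K θ := by
  have h1 : area K = (volume : Measure (ℝ × ℝ)).real
      (polarMap K x₀ '' (Set.Ioc 0 1 ×ˢ Set.Ioc 0 (2 * π))) := by
    rw [hK.image_polarMap hx₀, measureReal_def,
      measurePreserving_toPlane.measure_preimage
        (hK.isCompact.measurableSet.diff (measurableSet_singleton x₀)).nullMeasurableSet,
      measure_sdiff_null (measure_singleton x₀), area, measureReal_def]
  let D : ℝ × ℝ → ℝ × ℝ →L[ℝ] ℝ × ℝ := fun z =>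
    (Matrix.toLin (.finTwoProd ℝ) (.finTwoProd ℝ)
      !![boundaryCurve K z.2 0 - x₀ 0, z.1 * (curvRadius K z.2 * -sin z.2);
        boundaryCurve K z.2 1 - x₀ 1, z.1 * (curvRadius K z.2 * cos z.2)]).toContinuousLinearMap
  have hdet : ∀ z, (D z).det =
      z.1 * ((supportFun K z.2 - inner ℝ x₀ (unitVec z.2)) * curvRadius K z.2) := by
    intro z
    simp only [D, LinearMap.det_toContinuousLinearMap, LinearMap.det_toLin, Matrix.det_fin_two_of]
    rw [← inner_boundaryCurve, inner_unitVec, inner_unitVec]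
    ring
  have hD : ∀ z, HasFDerivAt (polarMap K x₀) (D z) z := by
    intro z
    simp only [D]
    rw [Matrix.toLin_finTwoProd_toContinuousLinearMap]
    have hγ := hasDerivAt_coord (hK.hasDerivAt_boundaryCurve z.2)
    have hc : ∀ i, HasFDerivAt (fun w : ℝ × ℝ => x₀ i + w.1 * (boundaryCurve K w.2 i - x₀ i))
        ((boundaryCurve K z.2 i - x₀ i) • ContinuousLinearMap.fst ℝ ℝ ℝ +
          (z.1 * (curvRadius K z.2 • unitTan z.2) i) • ContinuousLinearMap.snd ℝ ℝ ℝ) z := by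
      intro i
      have := (hasFDerivAt_fst (𝕜 := ℝ) (p := z)).mul
        ((((hγ i).comp_hasFDerivAt z (hasFDerivAt_snd (𝕜 := ℝ) (p := z))).sub_const (x₀ i)))
      refine (this.const_add (x₀ i)).congr_fderiv ?_
      ext <;> simp
    exact (hc 0).prodMk (hc 1)
  have hint := integral_image_eq_integral_abs_det_fderiv_smul (volume : Measure (ℝ × ℝ))
    (measurableSet_Ioc.prod measurableSet_Ioc) (fun z _ => (hD z).hasFDerivWithinAt)
    (hK.polarMap_injOn hx₀) (fun _ => (1 : ℝ))
  have hlhs : ∫ _ in polarMap K x₀ '' (Set.Ioc 0 1 ×ˢ Set.Ioc 0 (2 * π)), (1 : ℝ)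
      = (volume : Measure (ℝ × ℝ)).real
        (polarMap K x₀ '' (Set.Ioc 0 1 ×ˢ Set.Ioc 0 (2 * π))) := by
    simp
  rw [h1, ← hlhs, hint]
  have hrhs : ∫ z in Set.Ioc (0 : ℝ) 1 ×ˢ Set.Ioc 0 (2 * π), |(D z).det| • (1 : ℝ)
      = ∫ z in Set.Ioc (0 : ℝ) 1 ×ˢ Set.Ioc 0 (2 * π),
        z.1 * ((supportFun K z.2 - inner ℝ x₀ (unitVec z.2)) * curvRadius K z.2) := by
    refine setIntegral_congr_fun (measurableSet_Ioc.prod measurableSet_Ioc) fun z hz => ?_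
    simp only [smul_eq_mul, mul_one]
    rw [hdet, abs_of_nonneg]
    exact mul_nonneg hz.1.1.le (mul_nonneg (sub_nonneg.2 (hK.inner_lt_supportFun hx₀ _).le)
      (hK.curvRadius_nonneg _))
  rw [hrhs, Measure.volume_eq_prod, setIntegral_prod_mul (fun s : ℝ => s)
      (fun θ => (supportFun K θ - inner ℝ x₀ (unitVec θ)) * curvRadius K θ),
    ← intervalIntegral.integral_of_le zero_le_one, ← intervalIntegral.integral_of_le two_pi_pos.le,
    integral_id]
  norm_num

end IsSmoothStrictlyConvexDomain

/-! ### Length, area and deficit as integrals of the support function -/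

lemma integral_deriv_eq_zero {F F' : ℝ → ℝ} (hF : ∀ x, HasDerivAt F (F' x) x)
    (hF' : Continuous F') (hper : F (2 * π) = F 0) : ∫ x in (0 : ℝ)..2 * π, F' x = 0 := by
  rw [intervalIntegral.integral_eq_sub_of_hasDerivAt (fun x _ => hF x)
    (hF'.intervalIntegrable _ _), hper, sub_self]

namespace IsSmoothStrictlyConvexDomain

variable {K : Set Plane}

lemma eq_at_two_pi {α : Type*} {f : ℝ → α} (h : Function.Periodic f (2 * π)) :
    f (2 * π) = f 0 := by simpa using h 0

lemma deriv_supportFun_periodic (K : Set Plane) :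
    Function.Periodic (deriv (supportFun K)) (2 * π) := deriv_periodic (supportFun_periodic K)

lemma integral_supportFun (hK : IsSmoothStrictlyConvexDomain K) :
    ∫ θ in (0 : ℝ)..2 * π, supportFun K θ = perimeter K := by
  have hp := hK.continuous_supportFun
  have hR := hK.continuous_curvRadius
  have h := integral_deriv_eq_zero hK.hasDerivAt_deriv_supportFun (by fun_prop)
    (eq_at_two_pi (deriv_supportFun_periodic K))
  rw [intervalIntegral.integral_sub (hR.intervalIntegrable _ _) (hp.intervalIntegrable _ _),
    ← hK.perimeter_eq] at h
  linarith

lemma perimeter_nonneg (hK : IsSmoothStrictlyConvexDomain K) : 0 ≤ perimeter K := by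
  rw [hK.perimeter_eq]
  exact intervalIntegral.integral_nonneg two_pi_pos.le fun θ _ => hK.curvRadius_nonneg θ

/-- Over a full period this shows that `p + p''` is orthogonal to cosine and sine, so translations
do not affect the area integral. -/
lemma hasDerivAt_translation_primitive (hK : IsSmoothStrictlyConvexDomain K) (x : Plane) (θ : ℝ) :
    HasDerivAt (fun θ => deriv (supportFun K) θ * inner ℝ x (unitVec θ)
      - supportFun K θ * inner ℝ x (unitTan θ)) (inner ℝ x (unitVec θ) * curvRadius K θ) θ :=
  (((hK.hasDerivAt_deriv_supportFun θ).fun_mul (hasDerivAt_inner_unitVec x θ)).fun_sub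
    ((hK.hasDerivAt_supportFun θ).fun_mul (hasDerivAt_inner_unitTan x θ))).congr_deriv (by ring)

lemma area_eq (hK : IsSmoothStrictlyConvexDomain K) :
    2 * area K = ∫ θ in (0 : ℝ)..2 * π, supportFun K θ * curvRadius K θ := by
  obtain ⟨x, hx⟩ := hK.interior_nonempty
  have hp := hK.continuous_supportFun
  have hR := hK.continuous_curvRadius
  have hu := continuous_inner_unitVec x
  have h := integral_deriv_eq_zero (hK.hasDerivAt_translation_primitive x) (by fun_prop)
    (by simp only [eq_at_two_pi (deriv_supportFun_periodic K), eq_at_two_pi (supportFun_periodic K),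
      eq_at_two_pi unitVec_periodic, eq_at_two_pi unitTan_periodic])
  rw [hK.area_eq_integral_of_mem_interior hx]
  simp_rw [sub_mul]
  rw [intervalIntegral.integral_sub (by apply Continuous.intervalIntegrable; fun_prop)
    (by apply Continuous.intervalIntegrable; fun_prop), h]
  ring

/-- The deficit `∫ q'² - ∫ q²` of `q = p - ⟨x, u⟩ - r`. -/
lemma integral_deriv_sq_sub_integral_sq (hK : IsSmoothStrictlyConvexDomain K) (x : Plane) (r : ℝ) :
    (∫ θ in (0 : ℝ)..2 * π, (deriv (supportFun K) θ - inner ℝ x (unitTan θ)) ^ 2)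
      - ∫ θ in (0 : ℝ)..2 * π, (supportFun K θ - inner ℝ x (unitVec θ) - r) ^ 2
      = -2 * (area K - r * perimeter K + π * r ^ 2) := by
  have hp := hK.continuous_supportFun
  have hp' := hK.continuous_deriv_supportFun
  have hR := hK.continuous_curvRadius
  have hu := continuous_inner_unitVec x
  have ht := continuous_inner_unitTan x
  have hd : ∀ θ, HasDerivAt (fun θ =>
      (supportFun K θ - inner ℝ x (unitVec θ) - r)
        * (deriv (supportFun K) θ - inner ℝ x (unitTan θ))
      + (deriv (supportFun K) θ * inner ℝ x (unitVec θ)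
        - supportFun K θ * inner ℝ x (unitTan θ))
      - r * deriv (supportFun K) θ + r * inner ℝ x (unitTan θ))
      ((deriv (supportFun K) θ - inner ℝ x (unitTan θ)) ^ 2
        - (supportFun K θ - inner ℝ x (unitVec θ) - r) ^ 2 + supportFun K θ * curvRadius K θ
        - 2 * r * curvRadius K θ + r ^ 2) θ := by
    intro θ
    refine (((((((hK.hasDerivAt_supportFun θ).fun_sub (hasDerivAt_inner_unitVec x θ)).sub_const
      r).fun_mul ((hK.hasDerivAt_deriv_supportFun θ).fun_sub
      (hasDerivAt_inner_unitTan x θ))).fun_add (hK.hasDerivAt_translation_primitive x θ)).fun_sub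
      ((hK.hasDerivAt_deriv_supportFun θ).const_mul r)).fun_add
      ((hasDerivAt_inner_unitTan x θ).const_mul r)).congr_deriv ?_
    ring
  have h := integral_deriv_eq_zero hd (by fun_prop)
    (by simp only [eq_at_two_pi (deriv_supportFun_periodic K), eq_at_two_pi (supportFun_periodic K),
      eq_at_two_pi unitVec_periodic, eq_at_two_pi unitTan_periodic])
  rw [intervalIntegral.integral_add (by apply Continuous.intervalIntegrable; fun_prop)
      (by apply Continuous.intervalIntegrable; fun_prop),
    intervalIntegral.integral_sub (by apply Continuous.intervalIntegrable; fun_prop)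
      (by apply Continuous.intervalIntegrable; fun_prop),
    intervalIntegral.integral_add (by apply Continuous.intervalIntegrable; fun_prop)
      (by apply Continuous.intervalIntegrable; fun_prop),
    intervalIntegral.integral_sub (by apply Continuous.intervalIntegrable; fun_prop)
      (by apply Continuous.intervalIntegrable; fun_prop),
    intervalIntegral.integral_const_mul, intervalIntegral.integral_const, ← hK.perimeter_eq,
    ← hK.area_eq] at h
  simp only [smul_eq_mul] at h
  linarith

/-! ### Bonnesen's inequality -/

lemma circumradius_le (hK : IsSmoothStrictlyConvexDomain K) {x : Plane} {r : ℝ}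
    (h : ∀ θ, supportFun K θ ≤ inner ℝ x (unitVec θ) + r) : circumradius K ≤ r := by
  have hsub := (subset_closedBall_iff hK.isCompact hK.nonempty).2 h
  obtain ⟨y, hy⟩ := hK.nonempty
  exact csInf_le ⟨0, fun _ hr => hr.1⟩
    ⟨(norm_nonneg _).trans (mem_closedBall_iff_norm.1 (hsub hy)), x, hsub⟩

/-- The infimum is attained by compactness: a disk of radius at most `R` that contains `y ∈ K` has
its centre within `R` of `y`. -/
lemma exists_circumcenter (hK : IsSmoothStrictlyConvexDomain K) :
    ∃ x : Plane, ∀ θ, supportFun K θ ≤ inner ℝ x (unitVec θ) + circumradius K := by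
  obtain ⟨y, hy⟩ := hK.nonempty
  obtain ⟨R, hR⟩ := hK.isCompact.isBounded.subset_closedBall y
  have hR0 : 0 ≤ R := (norm_nonneg _).trans (mem_closedBall_iff_norm.1 (hR hy))
  have hcl : IsClosed {z : Plane × ℝ | ∀ θ, supportFun K θ ≤ inner ℝ z.1 (unitVec θ) + z.2} := by
    rw [Set.ofPred_forall]
    exact isClosed_iInter fun θ => isClosed_le continuous_const (by fun_prop)
  obtain ⟨⟨x, r⟩, ⟨⟨hx, hr⟩, hxr⟩, hmin⟩ :=
    (((isCompact_closedBall y R).prod (isCompact_Icc (a := 0) (b := R))).inter_right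
      hcl).exists_isMinOn (f := Prod.snd) ⟨(y, R), ⟨by simp [hR0], by simp [hR0]⟩,
        (subset_closedBall_iff hK.isCompact hK.nonempty).1 hR⟩ continuous_snd.continuousOn
  have hleast : IsLeast {r : ℝ | 0 ≤ r ∧ ∃ x : Plane, K ⊆ Metric.closedBall x r} r := by
    refine ⟨⟨hr.1, x, (subset_closedBall_iff hK.isCompact hK.nonempty).2 hxr⟩, ?_⟩
    rintro r' ⟨hr', x', hx'⟩
    rcases le_total r' R with h | h
    · refine hmin (a := (x', r')) ⟨⟨?_, hr', h⟩,
        (subset_closedBall_iff hK.isCompact hK.nonempty).1 hx'⟩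
      have := hx' hy
      rw [Metric.mem_closedBall'] at this
      exact this.trans h
    · exact hr.2.trans h
  refine ⟨x, ?_⟩
  rw [circumradius, hleast.csInf_eq]
  exact hxr

/-- Half the width of `K` along the `x`-axis bounds the radius of any disk inside; this makes the
search for an incenter compact. -/
lemma le_inradius_bound (K : Set Plane) {x : Plane} {r : ℝ}
    (h : ∀ θ, inner ℝ x (unitVec θ) + r ≤ supportFun K θ) :
    r ≤ (supportFun K 0 + supportFun K π) / 2 := by
  have h1 := h 0
  have h2 := h π
  simp only [inner_unitVec, cos_zero, sin_zero, cos_pi, sin_pi] at h1 h2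
  linarith

lemma le_inradius (hK : IsSmoothStrictlyConvexDomain K) {x : Plane} {r : ℝ} (hr : 0 ≤ r)
    (h : ∀ θ, inner ℝ x (unitVec θ) + r ≤ supportFun K θ) : r ≤ inradius K := by
  refine le_csSup ⟨(supportFun K 0 + supportFun K π) / 2, ?_⟩
    ⟨hr, x, (closedBall_subset_iff hK.isCompact hK.convex hK.nonempty hr).2 h⟩
  rintro r' ⟨hr', x', hx'⟩
  exact le_inradius_bound K
    ((closedBall_subset_iff hK.isCompact hK.convex hK.nonempty hr').1 hx')

lemma exists_incenter (hK : IsSmoothStrictlyConvexDomain K) :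
    0 ≤ inradius K ∧
      ∃ x : Plane, ∀ θ, inner ℝ x (unitVec θ) + inradius K ≤ supportFun K θ := by
  obtain ⟨y, hy⟩ := hK.nonempty
  have hcl : IsClosed {z : Plane × ℝ | ∀ θ, inner ℝ z.1 (unitVec θ) + z.2 ≤ supportFun K θ} := by
    rw [Set.ofPred_forall]
    exact isClosed_iInter fun θ => isClosed_le (by fun_prop) continuous_const
  have hy0 : ∀ θ, inner ℝ y (unitVec θ) + 0 ≤ supportFun K θ := fun θ => by
    simpa using inner_le_supportFun hK.isCompact hy θ
  obtain ⟨⟨x, r⟩, ⟨⟨hx, hr⟩, hxr⟩, hmax⟩ :=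
    ((hK.isCompact.prod (isCompact_Icc (a := 0)
      (b := (supportFun K 0 + supportFun K π) / 2))).inter_right
      hcl).exists_isMaxOn (f := Prod.snd) ⟨(y, 0), ⟨hy, le_rfl, le_inradius_bound K hy0⟩, hy0⟩
        continuous_snd.continuousOn
  have hgr : IsGreatest {r : ℝ | 0 ≤ r ∧ ∃ x : Plane, Metric.closedBall x r ⊆ K} r := by
    refine ⟨⟨hr.1, x, (closedBall_subset_iff hK.isCompact hK.convex hK.nonempty hr.1).2 hxr⟩, ?_⟩
    rintro r' ⟨hr', x', hx'⟩
    have h' := (closedBall_subset_iff hK.isCompact hK.convex hK.nonempty hr').1 hx'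
    exact hmax (a := (x', r'))
      ⟨⟨hx' (Metric.mem_closedBall_self hr'), hr', le_inradius_bound K h'⟩, h'⟩
  rw [inradius, hgr.csSup_eq]
  exact ⟨hr.1, x, hxr⟩

lemma inner_unitVec_unitVec (φ θ : ℝ) : inner ℝ (unitVec φ) (unitVec θ) = cos (θ - φ) := by
  rw [inner_unitVec, cos_sub]; simp; ring

/-- If a disk touches the boundary of `K` on each closed half of its own boundary, then its radius
lies between the roots of `A - L r + π r²`. -/
lemma steiner_polynomial_nonpos (hK : IsSmoothStrictlyConvexDomain K) {x : Plane} {r : ℝ}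
    (h : ∀ t, ∃ z ∈ Set.Icc t (t + π), supportFun K z - inner ℝ x (unitVec z) - r = 0) :
    area K - r * perimeter K + π * r ^ 2 ≤ 0 := by
  have := integral_sq_le_integral_deriv_sq_of_zero_on_arcs
    (q := fun θ => supportFun K θ - inner ℝ x (unitVec θ) - r)
    (q' := fun θ => deriv (supportFun K) θ - inner ℝ x (unitTan θ))
    (fun θ => ((hK.hasDerivAt_supportFun θ).fun_sub (hasDerivAt_inner_unitVec x θ)).sub_const r)
    (hK.continuous_deriv_supportFun.sub (continuous_inner_unitTan x))
    (fun θ => by simp only [supportFun_periodic K θ, unitVec_periodic θ])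
    (fun θ => by simp only [deriv_supportFun_periodic K θ, unitTan_periodic θ]) h
  have h2 := hK.integral_deriv_sq_sub_integral_sq x r
  linarith

/-- By minimality of the circumradius, no shift of the centre leaves room to shrink the disk, so
contact points occur on every closed half circle. -/
lemma steiner_polynomial_circumradius_nonpos (hK : IsSmoothStrictlyConvexDomain K) :
    area K - circumradius K * perimeter K + π * circumradius K ^ 2 ≤ 0 := by
  obtain ⟨x, hx⟩ := hK.exists_circumcenter
  refine hK.steiner_polynomial_nonpos (x := x) fun t => ?_
  obtain ⟨z, hz, hz0⟩ := exists_zero_of_not_movable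
    (q := fun θ => inner ℝ x (unitVec θ) + circumradius K - supportFun K θ)
    (((continuous_inner_unitVec x).add continuous_const).sub hK.continuous_supportFun)
    (fun θ => by simp only [supportFun_periodic K θ, unitVec_periodic θ])
    (fun θ => sub_nonneg.2 (hx θ)) (fun φ s ε hs hε => by
      by_contra! hcon
      have := hK.circumradius_le (x := x - s • unitVec φ) (r := circumradius K - ε) fun θ => by
        rw [inner_sub_left, inner_smul_left, inner_unitVec_unitVec]
        simp only [conj_trivial]
        linarith [hcon θ]
      linarith) t
  exact ⟨z, hz, by linarith⟩

/-- Dually, a closed half circle without contact would let the incircle move and grow. -/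
lemma steiner_polynomial_inradius_nonpos (hK : IsSmoothStrictlyConvexDomain K) :
    area K - inradius K * perimeter K + π * inradius K ^ 2 ≤ 0 := by
  obtain ⟨h0, x, hx⟩ := hK.exists_incenter
  refine hK.steiner_polynomial_nonpos (x := x) fun t => ?_
  obtain ⟨z, hz, hz0⟩ := exists_zero_of_not_movable
    (q := fun θ => supportFun K θ - inner ℝ x (unitVec θ) - inradius K)
    ((hK.continuous_supportFun.sub (continuous_inner_unitVec x)).sub continuous_const)
    (fun θ => by simp only [supportFun_periodic K θ, unitVec_periodic θ])
    (fun θ => by linarith [hx θ]) (fun φ s ε hs hε => by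
      by_contra! hcon
      have := hK.le_inradius (x := x + s • unitVec φ) (r := inradius K + ε) (by linarith)
        fun θ => by
          rw [inner_add_left, inner_smul_left, inner_unitVec_unitVec]
          simp only [conj_trivial]
          linarith [hcon θ]
      linarith) t
  exact ⟨z, hz, hz0⟩

/-- Bonnesen's inequality. -/
theorem bonnesen (hK : IsSmoothStrictlyConvexDomain K) :
    π ^ 2 * (circumradius K - inradius K) ^ 2 ≤ perimeter K ^ 2 - 4 * π * area K := by
  have h1 := hK.steiner_polynomial_circumradius_nonpos
  have h2 := hK.steiner_polynomial_inradius_nonpos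
  have h1' := mul_le_mul_of_nonneg_left h1 pi_pos.le
  have h2' := mul_le_mul_of_nonneg_left h2 pi_pos.le
  -- Twice the sum of `h1'` and `h2'`, plus this square, is the claim.
  nlinarith [sq_nonneg (π * circumradius K + π * inradius K - perimeter K)]

end IsSmoothStrictlyConvexDomain

/-! ### The deviation from the Steiner disk -/

lemma HasNoLowModes.of_hasDerivAt {f f' : ℝ → ℝ} (h : HasNoLowModes f)
    (hf : ∀ x, HasDerivAt f (f' x) x) (hf' : Continuous f') (hper : f (2 * π) = f 0) :
    HasNoLowModes f' := by
  have hfc : Continuous f := continuous_iff_continuousAt.2 fun x => (hf x).continuousAt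
  refine ⟨integral_deriv_eq_zero hf hf' hper, ?_, ?_⟩
  · have h1 := integral_deriv_eq_zero (fun x => (hf x).fun_mul (hasDerivAt_cos x)) (by fun_prop)
      (by simp [hper])
    simp only [mul_neg] at h1
    rw [intervalIntegral.integral_add (by apply Continuous.intervalIntegrable; fun_prop)
      (by apply Continuous.intervalIntegrable; fun_prop), intervalIntegral.integral_neg,
      h.integral_sin] at h1
    simpa using h1
  · have h1 := integral_deriv_eq_zero (fun x => (hf x).fun_mul (hasDerivAt_sin x)) (by fun_prop)
      (by simp)
    rw [intervalIntegral.integral_add (by apply Continuous.intervalIntegrable; fun_prop)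
      (by apply Continuous.intervalIntegrable; fun_prop), h.integral_cos] at h1
    simpa using h1

/-- The difference of the support functions of `K` and of its Steiner disk. -/
def deviation (K : Set Plane) (θ : ℝ) : ℝ :=
  supportFun K θ - inner ℝ (steinerPoint K) (unitVec θ) - perimeter K / (2 * π)

/-- The derivative of `deviation`. -/
def deviationDeriv (K : Set Plane) (θ : ℝ) : ℝ :=
  deriv (supportFun K) θ - inner ℝ (steinerPoint K) (unitTan θ)

/-- The second derivative of `deviation`. -/
def deviationDeriv2 (K : Set Plane) (θ : ℝ) : ℝ :=
  curvRadius K θ - perimeter K / (2 * π) - deviation K θ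

/-- The third derivative of `deviation`. -/
def deviationDeriv3 (K : Set Plane) (θ : ℝ) : ℝ :=
  deriv (curvRadius K) θ - deviationDeriv K θ

namespace IsSmoothStrictlyConvexDomain

variable {K : Set Plane}

lemma hasDerivAt_deviation (hK : IsSmoothStrictlyConvexDomain K) (θ : ℝ) :
    HasDerivAt (deviation K) (deviationDeriv K θ) θ :=
  ((hK.hasDerivAt_supportFun θ).fun_sub (hasDerivAt_inner_unitVec _ θ)).sub_const _

lemma hasDerivAt_deviationDeriv (hK : IsSmoothStrictlyConvexDomain K) (θ : ℝ) :
    HasDerivAt (deviationDeriv K) (deviationDeriv2 K θ) θ :=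
  ((hK.hasDerivAt_deriv_supportFun θ).fun_sub (hasDerivAt_inner_unitTan _ θ)).congr_deriv
    (by simp only [deviationDeriv2, deviation]; ring)

lemma hasDerivAt_deviationDeriv2 (hK : IsSmoothStrictlyConvexDomain K) (θ : ℝ) :
    HasDerivAt (deviationDeriv2 K) (deviationDeriv3 K θ) θ :=
  ((hK.hasDerivAt_curvRadius θ).sub_const _).fun_sub (hK.hasDerivAt_deviation θ)

lemma continuous_deviationDeriv (hK : IsSmoothStrictlyConvexDomain K) :
    Continuous (deviationDeriv K) :=
  continuous_iff_continuousAt.2 fun θ => (hK.hasDerivAt_deviationDeriv θ).continuousAt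

lemma continuous_deviationDeriv2 (hK : IsSmoothStrictlyConvexDomain K) :
    Continuous (deviationDeriv2 K) :=
  continuous_iff_continuousAt.2 fun θ => (hK.hasDerivAt_deviationDeriv2 θ).continuousAt

lemma continuous_deviationDeriv3 (hK : IsSmoothStrictlyConvexDomain K) :
    Continuous (deviationDeriv3 K) :=
  hK.continuous_deriv_curvRadius.sub hK.continuous_deviationDeriv

lemma deviation_eq_at_two_pi (K : Set Plane) : deviation K (2 * π) = deviation K 0 := by
  simp only [deviation, eq_at_two_pi (supportFun_periodic K), eq_at_two_pi unitVec_periodic]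

lemma deviationDeriv_eq_at_two_pi (K : Set Plane) :
    deviationDeriv K (2 * π) = deviationDeriv K 0 := by
  simp only [deviationDeriv, eq_at_two_pi (deriv_supportFun_periodic K),
    eq_at_two_pi unitTan_periodic]

lemma deviationDeriv2_eq_at_two_pi (K : Set Plane) :
    deviationDeriv2 K (2 * π) = deviationDeriv2 K 0 := by
  simp only [deviationDeriv2, eq_at_two_pi (curvRadius_periodic K), deviation_eq_at_two_pi]

lemma steinerPoint_apply (hK : IsSmoothStrictlyConvexDomain K) (i : Fin 2) :
    π * steinerPoint K i = ∫ θ in (0 : ℝ)..2 * π, supportFun K θ * unitVec θ i := by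
  have hc : Continuous fun θ => supportFun K θ • unitVec θ :=
    hK.continuous_supportFun.smul
      (continuous_iff_continuousAt.2 fun θ => (hasDerivAt_unitVec θ).continuousAt)
  have := (PiLp.proj (𝕜 := ℝ) 2 (fun _ : Fin 2 => ℝ) i).intervalIntegral_comp_comm
    (hc.intervalIntegrable (μ := volume) 0 (2 * π))
  simp only [PiLp.proj_apply, PiLp.smul_apply, smul_eq_mul] at this
  rw [this, steinerPoint]
  simp only [PiLp.smul_apply, smul_eq_mul]
  field_simp

/-- The mean of `p` is `L/(2π)`, and its first harmonic is the pairing with the Steiner point: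
subtracting the Steiner disk removes both. -/
lemma hasNoLowModes_deviation (hK : IsSmoothStrictlyConvexDomain K) :
    HasNoLowModes (deviation K) := by
  have hp := hK.continuous_supportFun
  have h0 := hK.steinerPoint_apply 0
  have h1 := hK.steinerPoint_apply 1
  simp only [unitVec_zero, unitVec_one] at h0 h1
  have hpi := pi_pos.ne'
  have hform : ∀ θ, deviation K θ = supportFun K θ
      - (steinerPoint K 0 * cos θ + steinerPoint K 1 * sin θ) - perimeter K / (2 * π) :=
    fun θ => by rw [deviation, inner_unitVec]
  refine ⟨?_, ?_, ?_⟩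
  · simp_rw [hform]
    rw [intervalIntegral.integral_sub (by apply Continuous.intervalIntegrable; fun_prop)
        (by apply Continuous.intervalIntegrable; fun_prop),
      intervalIntegral.integral_sub (by apply Continuous.intervalIntegrable; fun_prop)
        (by apply Continuous.intervalIntegrable; fun_prop),
      intervalIntegral.integral_add (by apply Continuous.intervalIntegrable; fun_prop)
        (by apply Continuous.intervalIntegrable; fun_prop), hK.integral_supportFun]
    simp only [intervalIntegral.integral_const_mul, intervalIntegral.integral_const, integral_cos,
      integral_sin]
    simp
    field_simp
    ring
  · have e : ∀ θ, deviation K θ * cos θ = supportFun K θ * cos θ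
        - (steinerPoint K 0 * cos θ ^ 2 + steinerPoint K 1 * (sin θ * cos θ))
        - perimeter K / (2 * π) * cos θ := fun θ => by rw [hform]; ring
    simp_rw [e]
    rw [intervalIntegral.integral_sub (by apply Continuous.intervalIntegrable; fun_prop)
        (by apply Continuous.intervalIntegrable; fun_prop),
      intervalIntegral.integral_sub (by apply Continuous.intervalIntegrable; fun_prop)
        (by apply Continuous.intervalIntegrable; fun_prop),
      intervalIntegral.integral_add (by apply Continuous.intervalIntegrable; fun_prop)
        (by apply Continuous.intervalIntegrable; fun_prop), ← h0]
    simp only [intervalIntegral.integral_const_mul, integral_cos, integral_cos_sq,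
      integral_sin_mul_cos₁]
    simp
    ring
  · have e : ∀ θ, deviation K θ * sin θ = supportFun K θ * sin θ
        - (steinerPoint K 0 * (sin θ * cos θ) + steinerPoint K 1 * sin θ ^ 2)
        - perimeter K / (2 * π) * sin θ := fun θ => by rw [hform]; ring
    simp_rw [e]
    rw [intervalIntegral.integral_sub (by apply Continuous.intervalIntegrable; fun_prop)
        (by apply Continuous.intervalIntegrable; fun_prop),
      intervalIntegral.integral_sub (by apply Continuous.intervalIntegrable; fun_prop)
        (by apply Continuous.intervalIntegrable; fun_prop),
      intervalIntegral.integral_add (by apply Continuous.intervalIntegrable; fun_prop)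
        (by apply Continuous.intervalIntegrable; fun_prop), ← h1]
    simp only [intervalIntegral.integral_const_mul, integral_sin, integral_sin_sq,
      integral_sin_mul_cos₁]
    simp
    ring

/-! ### The terms of `W` in terms of the deviation from the Steiner disk -/

lemma integral_deviationDeriv_sq_sub (hK : IsSmoothStrictlyConvexDomain K) :
    (∫ θ in (0 : ℝ)..2 * π, deviationDeriv K θ ^ 2) - ∫ θ in (0 : ℝ)..2 * π, deviation K θ ^ 2
      = perimeter K ^ 2 / (2 * π) - 2 * area K := by
  have := hK.integral_deriv_sq_sub_integral_sq (steinerPoint K) (perimeter K / (2 * π))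
  simp only [deviationDeriv, deviation]
  rw [this]
  field_simp
  ring

lemma integral_add_deriv2_sq {f f' f'' : ℝ → ℝ} (hf : ∀ x, HasDerivAt f (f' x) x)
    (hf' : ∀ x, HasDerivAt f' (f'' x) x) (hf'' : Continuous f'') (hper : f (2 * π) = f 0)
    (hper' : f' (2 * π) = f' 0) :
    ∫ x in (0 : ℝ)..2 * π, (f x + f'' x) ^ 2 = (∫ x in (0 : ℝ)..2 * π, f x ^ 2)
      - 2 * (∫ x in (0 : ℝ)..2 * π, f' x ^ 2) + ∫ x in (0 : ℝ)..2 * π, f'' x ^ 2 := by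
  have hfc : Continuous f := continuous_iff_continuousAt.2 fun x => (hf x).continuousAt
  have hfc' : Continuous f' := continuous_iff_continuousAt.2 fun x => (hf' x).continuousAt
  have h := integral_deriv_eq_zero (fun x => (hf x).fun_mul (hf' x)) (by fun_prop)
    (by rw [hper, hper'])
  rw [intervalIntegral.integral_add (by apply Continuous.intervalIntegrable; fun_prop)
    (by apply Continuous.intervalIntegrable; fun_prop)] at h
  have e : ∀ x, (f x + f'' x) ^ 2 = f x ^ 2 + 2 * (f x * f'' x) + f'' x ^ 2 := fun x => by ring
  simp_rw [e]
  rw [intervalIntegral.integral_add (by apply Continuous.intervalIntegrable; fun_prop)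
      (by apply Continuous.intervalIntegrable; fun_prop),
    intervalIntegral.integral_add (by apply Continuous.intervalIntegrable; fun_prop)
      (by apply Continuous.intervalIntegrable; fun_prop), intervalIntegral.integral_const_mul]
  simp_rw [← sq] at h
  linarith

lemma integral_curvRadius_sq (hK : IsSmoothStrictlyConvexDomain K) :
    ∫ θ in (0 : ℝ)..2 * π, curvRadius K θ ^ 2 = perimeter K ^ 2 / (2 * π)
      + ((∫ θ in (0 : ℝ)..2 * π, deviation K θ ^ 2)
      - 2 * (∫ θ in (0 : ℝ)..2 * π, deviationDeriv K θ ^ 2)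
      + ∫ θ in (0 : ℝ)..2 * π, deviationDeriv2 K θ ^ 2) := by
  have hR := hK.continuous_curvRadius
  rw [← integral_add_deriv2_sq hK.hasDerivAt_deviation hK.hasDerivAt_deviationDeriv
    hK.continuous_deviationDeriv2 (deviation_eq_at_two_pi K) (deviationDeriv_eq_at_two_pi K)]
  have e : ∀ θ, (deviation K θ + deviationDeriv2 K θ) ^ 2 = curvRadius K θ ^ 2
      - 2 * (perimeter K / (2 * π)) * curvRadius K θ + (perimeter K / (2 * π)) ^ 2 := fun θ => by
    simp only [deviationDeriv2]; ring
  simp_rw [e]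
  rw [intervalIntegral.integral_add (by apply Continuous.intervalIntegrable; fun_prop)
      (by apply Continuous.intervalIntegrable; fun_prop),
    intervalIntegral.integral_sub (by apply Continuous.intervalIntegrable; fun_prop)
      (by apply Continuous.intervalIntegrable; fun_prop), intervalIntegral.integral_const_mul,
    intervalIntegral.integral_const, ← hK.perimeter_eq]
  simp only [smul_eq_mul]
  field_simp
  ring

lemma integral_rhoBeta_sq (hK : IsSmoothStrictlyConvexDomain K) :
    ∫ θ in (0 : ℝ)..2 * π, rhoBeta K θ ^ 2 =
      (∫ θ in (0 : ℝ)..2 * π, deviationDeriv K θ ^ 2)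
      - 2 * (∫ θ in (0 : ℝ)..2 * π, deviationDeriv2 K θ ^ 2)
      + ∫ θ in (0 : ℝ)..2 * π, deviationDeriv3 K θ ^ 2 := by
  rw [← integral_add_deriv2_sq hK.hasDerivAt_deviationDeriv hK.hasDerivAt_deviationDeriv2
    hK.continuous_deviationDeriv3 (deviationDeriv_eq_at_two_pi K) (deviationDeriv2_eq_at_two_pi K)]
  simp only [hK.rhoBeta_eq, sq_abs, deviationDeriv3, add_sub_cancel]

lemma two_mul_centersArea (hK : IsSmoothStrictlyConvexDomain K) :
    2 * centersArea K = (∫ θ in (0 : ℝ)..2 * π, deviationDeriv K θ ^ 2)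
      - ∫ θ in (0 : ℝ)..2 * π, deviationDeriv2 K θ ^ 2 := by
  have hp' := hK.continuous_deriv_supportFun
  have hR' := hK.continuous_deriv_curvRadius
  have hf' := hK.continuous_deviationDeriv
  have hf'' := hK.continuous_deviationDeriv2
  have hd : ∀ θ, HasDerivAt (fun θ => deviationDeriv K θ * deviationDeriv2 K θ
      + inner ℝ (steinerPoint K) (unitTan θ) * curvRadius K θ
      + (deriv (supportFun K) θ * inner ℝ (steinerPoint K) (unitVec θ)
      - supportFun K θ * inner ℝ (steinerPoint K) (unitTan θ)))
      (deriv (supportFun K) θ * deriv (curvRadius K) θ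
        - (deviationDeriv K θ ^ 2 - deviationDeriv2 K θ ^ 2)) θ := by
    intro θ
    refine ((((hK.hasDerivAt_deviationDeriv θ).fun_mul (hK.hasDerivAt_deviationDeriv2 θ)).fun_add
      ((hasDerivAt_inner_unitTan _ θ).fun_mul (hK.hasDerivAt_curvRadius θ))).fun_add
      (hK.hasDerivAt_translation_primitive (steinerPoint K) θ)).congr_deriv ?_
    simp only [deviationDeriv3, deviationDeriv]
    ring
  have h := integral_deriv_eq_zero hd (by fun_prop)
    (by simp only [eq_at_two_pi (deriv_supportFun_periodic K), eq_at_two_pi (supportFun_periodic K),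
      eq_at_two_pi unitVec_periodic, eq_at_two_pi unitTan_periodic, deviationDeriv_eq_at_two_pi,
      deviationDeriv2_eq_at_two_pi, eq_at_two_pi (curvRadius_periodic K)])
  rw [intervalIntegral.integral_sub (by apply Continuous.intervalIntegrable; fun_prop)
      (by apply Continuous.intervalIntegrable; fun_prop),
    intervalIntegral.integral_sub (by apply Continuous.intervalIntegrable; fun_prop)
      (by apply Continuous.intervalIntegrable; fun_prop)] at h
  rw [hK.centersArea_eq]
  linarith

/-- Popoviciu's inequality for the curvature radius. -/
lemma integral_curvRadius_sq_le (hK : IsSmoothStrictlyConvexDomain K) :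
    (∫ θ in (0 : ℝ)..2 * π, curvRadius K θ ^ 2) - perimeter K ^ 2 / (2 * π)
      ≤ π / 2 * (rhoMax K - rhoMin K) ^ 2 := by
  have hR := hK.continuous_curvRadius
  have hcpt : IsCompact (rho K '' Set.Icc 0 (2 * π)) := by
    rw [funext hK.rho_eq]
    exact isCompact_Icc.image hR
  have hM : ∀ θ ∈ Set.Icc 0 (2 * π), curvRadius K θ ≤ rhoMax K := fun θ hθ =>
    le_csSup hcpt.bddAbove ⟨θ, hθ, hK.rho_eq θ⟩
  have hm : ∀ θ ∈ Set.Icc 0 (2 * π), rhoMin K ≤ curvRadius K θ := fun θ hθ =>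
    csInf_le hcpt.bddBelow ⟨θ, hθ, hK.rho_eq θ⟩
  set M := rhoMax K
  set m := rhoMin K
  -- The integrand is `(M - ρ)(ρ - m)`; completing the square in `L` then gives the bound.
  have h : 0 ≤ ∫ θ in (0 : ℝ)..2 * π, (M + m) * curvRadius K θ - M * m - curvRadius K θ ^ 2 :=
    intervalIntegral.integral_nonneg two_pi_pos.le fun θ hθ => by
      nlinarith [mul_nonneg (sub_nonneg.2 (hM θ hθ)) (sub_nonneg.2 (hm θ hθ))]
  rw [intervalIntegral.integral_sub (by apply Continuous.intervalIntegrable; fun_prop)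
      (by apply Continuous.intervalIntegrable; fun_prop),
    intervalIntegral.integral_sub (by apply Continuous.intervalIntegrable; fun_prop)
      (by apply Continuous.intervalIntegrable; fun_prop), intervalIntegral.integral_const_mul,
    intervalIntegral.integral_const, ← hK.perimeter_eq] at h
  simp only [smul_eq_mul, sub_zero] at h
  have e : (M + m) * perimeter K - 2 * π * (M * m) - perimeter K ^ 2 / (2 * π)
      = π / 2 * (M - m) ^ 2 - (perimeter K - π * (M + m)) ^ 2 / (2 * π) := by
    field_simp; ring
  have : 0 ≤ (perimeter K - π * (M + m)) ^ 2 / (2 * π) := by positivity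
  linarith

/-! ### Stability -/

/-- The isoperimetric deficit is controlled by `W`. -/
lemma deficit_le_W (hK : IsSmoothStrictlyConvexDomain K) {P : ParameterSet}
    (hP : P.StabilityCondition) :
    (6 * π * P.α - π * P.μ + 4 * π * P.σ + 24 * π * P.η + 4 * P.lam + 4 * P.ξ - 12 * π * P.ζ)
      * ((∫ θ in (0 : ℝ)..2 * π, deviationDeriv K θ ^ 2)
        - ∫ θ in (0 : ℝ)..2 * π, deviation K θ ^ 2) ≤ 2 * π * W P K := by
  obtain ⟨⟨hη, hξ, hζ⟩, hlam, hc1, hc2, -⟩ := hP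
  have hlow := hK.hasNoLowModes_deviation
  have hlow' := hlow.of_hasDerivAt hK.hasDerivAt_deviation hK.continuous_deviationDeriv
    (deviation_eq_at_two_pi K)
  have w0 := hlow.four_mul_integral_sq_le hK.hasDerivAt_deviation hK.continuous_deviationDeriv
    (deviation_eq_at_two_pi K)
  have w1 := hlow'.four_mul_integral_sq_le hK.hasDerivAt_deviationDeriv
    hK.continuous_deviationDeriv2 (deviationDeriv_eq_at_two_pi K)
  have s0 := hlow.five_mul_integral_deriv_sq_le hK.hasDerivAt_deviation
    hK.hasDerivAt_deviationDeriv hK.continuous_deviationDeriv2 (deviation_eq_at_two_pi K)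
    (deviationDeriv_eq_at_two_pi K)
  have s1 := hlow'.five_mul_integral_deriv_sq_le hK.hasDerivAt_deviationDeriv
    hK.hasDerivAt_deviationDeriv2 hK.continuous_deviationDeriv3 (deviationDeriv_eq_at_two_pi K)
    (deviationDeriv2_eq_at_two_pi K)
  have hA := hK.integral_deviationDeriv_sq_sub
  have hρ := hK.integral_curvRadius_sq
  have hpop := hK.integral_curvRadius_sq_le
  have hbon := hK.bonnesen
  have hen := curvatureEnergy_nonneg K
  have hρ0 : 0 ≤ ∫ θ in (0 : ℝ)..2 * π, curvRadius K θ ^ 2 :=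
    intervalIntegral.integral_nonneg two_pi_pos.le fun θ _ => sq_nonneg _
  have hca := hK.two_mul_centersArea
  have hb0 : 0 ≤ ∫ θ in (0 : ℝ)..2 * π, deviation K θ ^ 2 :=
    intervalIntegral.integral_nonneg two_pi_pos.le fun θ _ => sq_nonneg _
  rw [W, hK.integral_rhoBeta_sq]
  simp only [hK.rho_eq]
  set b₀ := ∫ θ in (0 : ℝ)..2 * π, deviation K θ ^ 2
  set b₁ := ∫ θ in (0 : ℝ)..2 * π, deviationDeriv K θ ^ 2
  set b₂ := ∫ θ in (0 : ℝ)..2 * π, deviationDeriv2 K θ ^ 2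
  set b₃ := ∫ θ in (0 : ℝ)..2 * π, deviationDeriv3 K θ ^ 2
  -- The Wirtinger inequalities give `b₁ ≤ b₂`, so the oriented area of the evolute is nonpositive.
  have habs : |centersArea K| = (b₂ - b₁) / 2 := by
    rw [abs_of_nonpos (by linarith)]; linarith
  rw [habs]
  set I := ∫ θ in (0 : ℝ)..2 * π, curvRadius K θ ^ 2
  set L := perimeter K
  set A := area K
  set r := circumradius K - inradius K
  set o := rhoMax K - rhoMin K
  have hpi := pi_pos
  have hbon' : π * r ^ 2 ≤ 2 * (b₁ - b₀) := by
    have : π * (π * r ^ 2) ≤ π * (2 * (b₁ - b₀)) := by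
      rw [hA]
      have e : π * (2 * (L ^ 2 / (2 * π) - 2 * A)) = L ^ 2 - 4 * π * A := by field_simp; ring
      rw [e]; linarith
    exact le_of_mul_le_mul_left this hpi
  have hosc : 2 * (b₁ - b₀) ≤ π * o ^ 2 := by
    have : 0 ≤ π * o ^ 2 := by positivity
    linarith
  have hlam' := mul_nonneg (neg_nonneg.2 hlam) (sub_nonneg.2 hbon')
  have hξ' := mul_nonneg hξ (sub_nonneg.2 hosc)
  have hζ' : 0 ≤ π * P.ζ * (2 * I + curvatureEnergy K) := by positivity
  have hζ1 : 0 ≤ π * (P.ζ * curvatureEnergy K) := by positivity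
  set q := L ^ 2 / (2 * π) with hq
  have hq0 : 0 ≤ q := by positivity
  have hL : L ^ 2 = 2 * π * q := by rw [hq]; field_simp
  have hAq : A = (q - (b₁ - b₀)) / 2 := by linarith
  have t1 := mul_nonneg hpi.le (mul_nonneg hc1 hq0)
  -- Up to the slack of `s1`, `b₁ - 2b₂ + b₃` equals `3(b₂ - b₁)`, so `2η` times it contributes `6η`
  -- to the weight of `s0`.
  have hc2' : 0 ≤ 2 * P.α + P.σ - 4 * P.ζ + 6 * P.η := by linarith
  have t2 := mul_nonneg hpi.le (mul_nonneg hc2' (sub_nonneg.2 s0))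
  have t3 := mul_nonneg hpi.le (mul_nonneg hη (sub_nonneg.2 s1))
  -- The corrections `-4ζ` in the weights of `t1` and `t2` and `-12πζ` in the factor of `d` add up
  -- to exactly `-4πζ I`.
  have hζI : 0 ≤ π * (P.ζ * I) := by positivity
  rw [hL, hAq, hρ] at *
  linarith [hlam', hξ', hζ1, hζI, t1, t2, t3]

lemma supportFun_sub_supportFun_steinerDisk (hK : IsSmoothStrictlyConvexDomain K) (θ : ℝ) :
    supportFun K θ - supportFun (steinerDisk K) θ = deviation K θ := by
  rw [steinerDisk, supportFun_closedBall _ (div_nonneg hK.perimeter_nonneg two_pi_pos.le),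
    deviation]
  ring

lemma h2_steinerDisk_sq_le (hK : IsSmoothStrictlyConvexDomain K) :
    h2 K (steinerDisk K) ^ 2 ≤ 3 * π * ((∫ θ in (0 : ℝ)..2 * π, deviationDeriv K θ ^ 2)
      - ∫ θ in (0 : ℝ)..2 * π, deviation K θ ^ 2) := by
  have w0 := hK.hasNoLowModes_deviation.four_mul_integral_sq_le hK.hasDerivAt_deviation
    hK.continuous_deviationDeriv (deviation_eq_at_two_pi K)
  have hb0 : 0 ≤ ∫ θ in (0 : ℝ)..2 * π, deviation K θ ^ 2 :=
    intervalIntegral.integral_nonneg two_pi_pos.le fun θ _ => sq_nonneg _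
  simp only [h2, hK.supportFun_sub_supportFun_steinerDisk, sq_abs]
  rw [Real.sq_sqrt hb0]
  -- Here `b₀ ≤ d/3` already holds; the larger constant `3π` is the one shared with `h1`.
  nlinarith [pi_gt_three]

lemma h1_steinerDisk_sq_le (hK : IsSmoothStrictlyConvexDomain K) :
    h1 K (steinerDisk K) ^ 2 ≤ 3 * π * ((∫ θ in (0 : ℝ)..2 * π, deviationDeriv K θ ^ 2)
      - ∫ θ in (0 : ℝ)..2 * π, deviation K θ ^ 2) := by
  have w0 := hK.hasNoLowModes_deviation.four_mul_integral_sq_le hK.hasDerivAt_deviation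
    hK.continuous_deviationDeriv (deviation_eq_at_two_pi K)
  have hb1 : 0 ≤ ∫ θ in (0 : ℝ)..2 * π, deviationDeriv K θ ^ 2 :=
    intervalIntegral.integral_nonneg two_pi_pos.le fun θ _ => sq_nonneg _
  simp only [h1, hK.supportFun_sub_supportFun_steinerDisk]
  set B := 2 * π * ∫ θ in (0 : ℝ)..2 * π, deviationDeriv K θ ^ 2 with hB
  have hB0 : 0 ≤ B := by positivity
  have hle : sSup ((fun θ => |deviation K θ|) '' Set.Icc 0 (2 * π)) ≤ √B := by
    refine Real.sSup_le ?_ (Real.sqrt_nonneg _)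
    rintro _ ⟨θ, hθ, rfl⟩
    exact Real.abs_le_sqrt (sq_le_integral_deriv_sq_of_integral_eq_zero hK.hasDerivAt_deviation
      hK.continuous_deviationDeriv hK.hasNoLowModes_deviation.integral_eq_zero hθ)
  have h0 : 0 ≤ sSup ((fun θ => |deviation K θ|) '' Set.Icc 0 (2 * π)) := by
    refine Real.sSup_nonneg ?_
    rintro _ ⟨θ, -, rfl⟩
    exact abs_nonneg _
  calc _ ≤ √B ^ 2 := pow_le_pow_left₀ h0 hle 2
    _ = B := Real.sq_sqrt hB0
    -- From `4b₀ ≤ b₁` follows `b₁ ≤ 4d/3`, so `2πb₁ ≤ 8πd/3 ≤ 3πd`.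
    _ ≤ _ := by rw [hB]; nlinarith [pi_pos]

end IsSmoothStrictlyConvexDomain

lemma stableFor_of_sq_le {P : ParameterSet} (hP : P.StabilityCondition)
    {h : Set Plane → Set Plane → ℝ}
    (hle : ∀ K, IsSmoothStrictlyConvexDomain K → h K (steinerDisk K) ^ 2 ≤
      3 * π * ((∫ θ in (0 : ℝ)..2 * π, deviationDeriv K θ ^ 2)
        - ∫ θ in (0 : ℝ)..2 * π, deviation K θ ^ 2)) : StableFor h P := by
  have hpos := hP.2.2.2.2
  have hpi := pi_pos
  set κ := 6 * π * P.α - π * P.μ + 4 * π * P.σ + 24 * π * P.η + 4 * P.lam + 4 * P.ξ - 12 * π * P.ζ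
    with hκ
  refine ⟨3 * π * (2 * π / κ), by positivity, fun K hK => (hle K hK).trans ?_⟩
  have h1 := hK.deficit_le_W hP
  rw [← hκ, mul_comm κ, ← le_div_iff₀ hpos] at h1
  calc _ ≤ 3 * π * (2 * π * W P K / κ) := by gcongr
    _ = _ := by ring

end ParametricIsoperimetric

end

theorem corollary4 (P : ParametricIsoperimetric.ParameterSet) (hP : P.StabilityCondition) :
    ParametricIsoperimetric.IsStable P :=
  ⟨ParametricIsoperimetric.stableFor_of_sq_le hP fun _ hK => hK.h1_steinerDisk_sq_le,
    ParametricIsoperimetric.stableFor_of_sq_le hP fun _ hK => hK.h2_steinerDisk_sq_le⟩
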